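/- Let $H$ be a complex Hilbert space, let $A$ be a bounded operator on $H$ with $A\ge \epsilon 1$ for some $\epsilon>0$, let $P_1,P_2$ be orthogonal projections on $H$ with $P_1+P_2=1$, and put $B=P_1AP_1+P_2AP_2$. Assume that $A-B$ is trace class. Let $p$ be an orthogonal projection of finite rank on $H$ that commutes with $P_1$, and write $X_p=pXp$. Then $A(\ln A-\ln B)$ and $A_p(\ln A_p-\ln B_p)$ are trace class operators with real traces, and $$\mathrm{Tr}\big(A(\ln A-\ln B)\big)\ \ge\ \mathrm{Tr}\big(A_p(\ln A_p-\ln B_p)\big).$$ Here $\ln A_p$ and $\ln B_p$ denote the logarithms of the strictly positive operators induced by $A_p$ and $B_p$ on the range of $p$, extended by $0$ on its orthogonal complement. -/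

import Mathlib

open scoped InnerProductSpace

noncomputable section

namespace TraceIneq

variable {H : Type*} [NormedAddCommGroup H] [InnerProductSpace ℂ H] [CompleteSpace H]

/-- A bounded operator `T` on a Hilbert space is trace class if `∑ ⟨e, |T| e⟩ < ∞`,
`|T| = (T* T)^{1/2}`, along every orthonormal Hilbert basis (the terms are nonnegative and the
sum does not depend on the basis). -/
def IsTraceClass (T : H →L[ℂ] H) : Prop :=
  ∀ (w : Set H) (b : HilbertBasis w ℂ H), Summable fun i => (⟪b i, CFC.abs T (b i)⟫_ℂ).re

variable (H) in
/-- The index set of a fixed orthonormal Hilbert basis of `H`. -/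
def basisIndex : Set H := (exists_hilbertBasis ℂ H).choose

variable (H) in
/-- A fixed orthonormal Hilbert basis of `H`. -/
def basis : HilbertBasis (basisIndex H) ℂ H := (exists_hilbertBasis ℂ H).choose_spec.choose

/-- The trace `Tr T = ∑ ⟨e, T e⟩`; for trace class `T` the sum converges absolutely and does not
depend on the basis. -/
def trace (T : H →L[ℂ] H) : ℂ := ∑' i, ⟪basis H i, T (basis H i)⟫_ℂ

/-- The compression `X_p = p X p`, an operator on `H` vanishing on the complement of the range
of `p`. -/
def compr (p X : H →L[ℂ] H) : H →L[ℂ] H := p * X * p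

/-- The operator `X (ln X - ln Y)`, with logarithms from the continuous functional calculus for
self-adjoint operators. As `Real.log 0 = 0`, for `X = p A p` with `A ≥ ε > 0` the operator
`CFC.log X` is the logarithm of the strictly positive operator that `X` induces on the range of
`p`, extended by zero on the orthogonal complement; `X (ln X - ln Y)` for two compressions by the
same `p` is therefore computed on the range of `p`. -/
def entropyOp (X Y : H →L[ℂ] H) : H →L[ℂ] H := X * (CFC.log X - CFC.log Y)

end TraceIneq

end

/-!
# A trace inequality for pinchings and compressions

The relative entropy `Tr A (ln A - ln B)` of `A` and its pinching `B` does not increase when both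
operators are compressed by a finite-rank projection `p` that commutes with `P₁`.

For finite rank the trace equals `Tr h(A) - Tr h(B)` with `h x = x log x`
(`TraceIneq.IsFrame.tsum_inner_entropyOp`), because `ln B` commutes with `P₁`. For matrices the
inequality is `Matrix.entropy_block_le`. Replace `A` by `A + t`. The derivative in `t` of the
difference of the two sides is the logarithm of
`det (A + t) det (B_p + t) / (det (B + t) det (A_p + t))`, and this quotient is at most `1`
(`Matrix.det_mul_det_pinch_le`): after division by the corners it becomes `det S / det S'`, where
`S` and `S'` are the Schur complements of `A + t` and `B + t`, and the pinching of `S` is at most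
`S'`. The difference decreases in `t` and vanishes at infinity (`sum_mul_log_sub_le`), so it is
nonnegative at `t = 0`.

The passage to infinite dimension uses the power series of the logarithm around a number
`M ≥ ‖A‖, ‖B‖` (`TraceIneq.hasSum_log_compr`). It expands `A_p (ln A_p - ln B_p)`, for every
projection `p` including `p = 1`, into terms `L (A - B) R`. Writing the trace class operator
`A - B` as a product `S Q` of self-adjoint Hilbert–Schmidt operators gives each term a trace norm
bound and the trace `∑ ⟨Q e, R L S e⟩`, and the bounds form a geometric series that does not depend
on `p`. Trace class membership follows, and dominated convergence
(`TraceIneq.tendsto_tsum_logTrace`) gives convergence of the traces along a net of finite-rank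
projections `q ≥ p` that commute with `P₁` and converge strongly to `1`. The limit of the
finite-rank inequality is the theorem.
-/

/-! ### Sums of `x log x` -/

open Filter Topology in
/-- If the products of the shifted entries satisfy `∏(a+t)·∏(d+t) ≤ ∏(b+t)·∏(c+t)` for all `t ≥ 0`
and the sums match, then the corresponding combination of `x log x` sums has a sign. The
combination of the sums of `(x + t) log (x + t)` has the logarithm of the quotient of the two
products as its derivative in `t`, hence decreases, and it tends to `0` as `t → ∞` because the
sums match. -/
theorem sum_mul_log_sub_le {ι κ : Type*} [Fintype ι] [Fintype κ] (a b : ι → ℝ) (c d : κ → ℝ)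
    (ha : ∀ i, 0 < a i) (hb : ∀ i, 0 < b i) (hc : ∀ k, 0 < c k) (hd : ∀ k, 0 < d k)
    (hab : ∑ i, a i = ∑ i, b i) (hcd : ∑ k, c k = ∑ k, d k)
    (h : ∀ t : ℝ, 0 ≤ t →
      (∏ i, (a i + t)) * ∏ k, (d k + t) ≤ (∏ i, (b i + t)) * ∏ k, (c k + t)) :
    ∑ k, c k * Real.log (c k) - ∑ k, d k * Real.log (d k) ≤
      ∑ i, a i * Real.log (a i) - ∑ i, b i * Real.log (b i) := by
  set g : ℝ → ℝ → ℝ := fun x t => (x + t) * Real.log (x + t) with hg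
  set G : ℝ → ℝ := fun t =>
    (∑ i, g (a i) t - ∑ i, g (b i) t) - (∑ k, g (c k) t - ∑ k, g (d k) t) with hG
  have hgd : ∀ x t : ℝ, 0 < x → 0 ≤ t → HasDerivAt (g x) (Real.log (x + t) + 1) t := by
    intro x t hx ht
    have := (Real.hasDerivAt_mul_log (x := x + t) (by positivity)).comp t
      ((hasDerivAt_id t).const_add x)
    rw [mul_one] at this; exact this
  have hGd : ∀ t, 0 ≤ t → HasDerivAt G
      ((∑ i, (Real.log (a i + t) + 1) - ∑ i, (Real.log (b i + t) + 1)) -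
        (∑ k, (Real.log (c k + t) + 1) - ∑ k, (Real.log (d k + t) + 1))) t := by
    intro t ht
    exact ((HasDerivAt.fun_sum fun i _ => hgd _ _ (ha i) ht).sub
      (HasDerivAt.fun_sum fun i _ => hgd _ _ (hb i) ht)).sub
      ((HasDerivAt.fun_sum fun i _ => hgd _ _ (hc i) ht).sub
      (HasDerivAt.fun_sum fun i _ => hgd _ _ (hd i) ht))
  have hanti : AntitoneOn G (Set.Ici 0) := by
    refine antitoneOn_of_deriv_nonpos (convex_Ici 0)
      (fun t ht => (hGd t ht).continuousAt.continuousWithinAt)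
      (fun t ht => (hGd t (interior_subset ht)).differentiableAt.differentiableWithinAt) ?_
    intro t ht
    have ht0 : 0 ≤ t := interior_subset ht
    rw [(hGd t ht0).deriv]
    simp only [Finset.sum_add_distrib]
    have hp : ∀ {σ : Type _} [Fintype σ] (u : σ → ℝ), (∀ i, 0 < u i) →
        0 < ∏ i, (u i + t) := fun u hu =>
      Finset.prod_pos fun i _ => add_pos_of_pos_of_nonneg (hu i) ht0
    have hl := Real.log_le_log (mul_pos (hp a ha) (Finset.prod_pos fun i _ =>
      add_pos_of_pos_of_nonneg (hd i) ht0)) (h t ht0)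
    have e : ∀ i, a i + t ≠ 0 := fun i => (add_pos_of_pos_of_nonneg (ha i) ht0).ne'
    have e2 : ∀ i, b i + t ≠ 0 := fun i => (add_pos_of_pos_of_nonneg (hb i) ht0).ne'
    have e3 : ∀ i, c i + t ≠ 0 := fun i => (add_pos_of_pos_of_nonneg (hc i) ht0).ne'
    have e4 : ∀ i, d i + t ≠ 0 := fun i => (add_pos_of_pos_of_nonneg (hd i) ht0).ne'
    rw [Real.log_mul (Finset.prod_ne_zero_iff.2 fun i _ => e i)
        (Finset.prod_ne_zero_iff.2 fun i _ => e4 i),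
      Real.log_mul (Finset.prod_ne_zero_iff.2 fun i _ => e2 i)
        (Finset.prod_ne_zero_iff.2 fun i _ => e3 i),
      Real.log_prod (fun i _ => e i), Real.log_prod (fun i _ => e2 i),
      Real.log_prod (fun i _ => e3 i), Real.log_prod (fun i _ => e4 i)] at hl
    linarith
  -- the terms `(x + t) log t` cancel in `G`, since they depend on the family only through its size
  -- and its sum
  have hlim1 : ∀ x : ℝ, 0 < x →
      Tendsto (fun t => g x t - (x + t) * Real.log t) atTop (𝓝 x) := by
    intro x hx
    have h1 := Real.tendsto_mul_log_one_add_div_atTop x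
    have h2 : Tendsto (fun t : ℝ => x * Real.log (1 + x / t)) atTop (𝓝 0) := by
      have : Tendsto (fun t : ℝ => 1 + x / t) atTop (𝓝 1) := by
        simpa using (tendsto_const_nhds (x := (1 : ℝ))).add
          (tendsto_const_nhds.div_atTop tendsto_id)
      simpa using ((Real.continuousAt_log one_ne_zero).tendsto.comp this).const_mul x
    have h3 := h2.add h1
    rw [zero_add] at h3
    refine h3.congr' ?_
    filter_upwards [eventually_gt_atTop 0] with t ht
    have : x + t = t * (1 + x / t) := by field_simp; ring
    have h5 : Real.log (x + t) = Real.log t + Real.log (1 + x / t) := by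
      rw [this, Real.log_mul ht.ne' (by positivity)]
    simp only [hg, h5]; ring
  have hlim : Tendsto G atTop (𝓝 0) := by
    have h1 := ((tendsto_finsetSum Finset.univ fun i _ => hlim1 (a i) (ha i)).sub
      (tendsto_finsetSum Finset.univ fun i _ => hlim1 (b i) (hb i))).sub
      ((tendsto_finsetSum Finset.univ fun i _ => hlim1 (c i) (hc i)).sub
      (tendsto_finsetSum Finset.univ fun i _ => hlim1 (d i) (hd i)))
    rw [hab, hcd, sub_self, sub_self, sub_self] at h1
    refine h1.congr fun t => ?_
    simp only [Finset.sum_sub_distrib, ← Finset.sum_mul, Finset.sum_add_distrib, hab, hcd, hG]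
    ring
  have h0 : 0 ≤ G 0 := by
    refine le_of_tendsto hlim ?_
    filter_upwards [eventually_ge_atTop 0] with t ht
    exact hanti Set.self_mem_Ici ht ht
  simp only [hG, hg, add_zero] at h0
  linarith

/-! ### Determinants and entropies of pinched matrices -/

namespace Matrix

open scoped ComplexOrder Matrix

theorem PosDef.add_smul_one {n : Type*} [DecidableEq n] {M : Matrix n n ℂ} (hM : M.PosDef) {t : ℝ}
    (ht : 0 ≤ t) :
    (M + (t : ℂ) • 1).PosDef :=
  hM.add_posSemidef (PosSemidef.one.smul (by exact_mod_cast ht))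

variable {m n : Type*} [Fintype m] [Fintype n] [DecidableEq m] [DecidableEq n]

/-- The arithmetic-geometric mean inequality for the eigenvalues of `Y^{-1/2} X Y^{-1/2}`, in a form
that covers both monotonicity of the determinant and Fischer's inequality for pinchings. -/
theorem PosDef.det_le_det_of_trace_le {X Y : Matrix n n ℂ} (hX : X.PosDef) (hY : Y.PosDef)
    (h : (Y⁻¹ * X).trace.re ≤ Fintype.card n) : X.det ≤ Y.det := by
  obtain ⟨C, hC⟩ : ∃ C : Matrix n n ℂ, Y = Cᴴ * C := by
    open scoped MatrixOrder in
    exact CStarAlgebra.nonneg_iff_eq_star_mul_self.1 (nonneg_iff_posSemidef.2 hY.posSemidef)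
  have hCu : IsUnit C.det := by
    have := (isUnit_iff_isUnit_det _).1 hY.isUnit
    rw [hC, det_mul] at this
    exact isUnit_of_mul_isUnit_right this
  have hCs : IsUnit Cᴴ.det := by rw [det_conjTranspose]; exact hCu.star
  set Z : Matrix n n ℂ := (C⁻¹)ᴴ * X * C⁻¹ with hZ
  have hZp : Z.PosDef := by
    refine hX.conjTranspose_mul_mul_same (B := C⁻¹) ?_
    exact mulVec_injective_of_isUnit ((isUnit_iff_isUnit_det _).2 (isUnit_nonsing_inv_det _ hCu))
  have htr : Z.trace = (Y⁻¹ * X).trace := by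
    rw [hZ, trace_mul_comm, ← Matrix.mul_assoc, hC, mul_inv_rev, conjTranspose_nonsing_inv]
  have hdet : X.det = Y.det * Z.det := by
    have : X = Cᴴ * Z * C := by
      rw [hZ, conjTranspose_nonsing_inv]
      simp only [Matrix.mul_assoc, nonsing_inv_mul _ hCu, Matrix.mul_one]
      rw [← Matrix.mul_assoc, mul_nonsing_inv _ hCs, Matrix.one_mul]
    rw [this, hC]; simp only [det_mul]; ring
  have hZ1 : Z.det ≤ 1 := by
    rw [hZp.isHermitian.det_eq_prod_eigenvalues]
    rw [← htr, hZp.isHermitian.trace_eq_sum_eigenvalues] at h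
    have h' : ∑ i, hZp.isHermitian.eigenvalues i ≤ Fintype.card n := by
      simpa using h
    have : ∏ i, hZp.isHermitian.eigenvalues i ≤ 1 := by
      calc ∏ i, hZp.isHermitian.eigenvalues i
          ≤ ∏ i, Real.exp (hZp.isHermitian.eigenvalues i - 1) := by
            refine Finset.prod_le_prod (fun i _ => (hZp.eigenvalues_pos i).le) fun i _ => ?_
            linarith [Real.add_one_le_exp (hZp.isHermitian.eigenvalues i - 1)]
        _ ≤ 1 := by
            rw [← Real.exp_sum, Real.exp_le_one_iff, Finset.sum_sub_distrib]
            simpa using h'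
    have h3 := Complex.real_le_real.2 this
    simpa using h3
  rw [hdet]
  simpa using mul_le_mul_of_nonneg_left hZ1 hY.det_pos.le

/-- The pinching `P M P + (1 - P) M (1 - P)` of `M` by `P`, which deletes the blocks of `M` that are
off-diagonal with respect to `P`. -/
def pinch (P M : Matrix n n ℂ) : Matrix n n ℂ := P * M * P + (1 - P) * M * (1 - P)

theorem PosSemidef.pinch {P M : Matrix n n ℂ} (hM : M.PosSemidef) (hP : Pᴴ = P) :
    (pinch P M).PosSemidef := by
  have h1 := hM.conjTranspose_mul_mul_same P
  have h2 := hM.conjTranspose_mul_mul_same (1 - P)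
  rw [conjTranspose_sub, conjTranspose_one] at h2
  rw [hP] at h1 h2
  exact h1.add h2

theorem trace_pinch {P : Matrix n n ℂ} (hP : P * P = P) (M : Matrix n n ℂ) :
    (pinch P M).trace = M.trace := by
  have h2 : (1 - P) * (1 - P) = 1 - P := IsIdempotentElem.one_sub hP
  rw [pinch, trace_add, trace_mul_cycle, hP, trace_mul_cycle, h2, ← trace_add, ← add_mul]
  simp

theorem pinch_add_smul_one {P : Matrix n n ℂ} (hP : P * P = P) (M : Matrix n n ℂ) (t : ℂ) :
    pinch P (M + t • 1) = pinch P M + t • 1 := by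
  have h2 : (1 - P) * (1 - P) = 1 - P := IsIdempotentElem.one_sub hP
  simp only [pinch, mul_add, add_mul, mul_smul_comm, smul_mul_assoc, mul_one, hP, h2]
  have : t • (1 : Matrix n n ℂ) = t • P + t • (1 - P) := by rw [← smul_add]; simp
  rw [this]; abel

theorem PosDef.pinch {P M : Matrix n n ℂ} (hM : M.PosDef) (hP : Pᴴ = P) :
    (pinch P M).PosDef := by
  refine (hM.posSemidef.pinch hP).posDef_iff_det_ne_zero.2 fun h0 => ?_
  obtain ⟨v, hv, hv0⟩ := exists_mulVec_eq_zero_iff.2 h0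
  have h1 := hM.posSemidef.conjTranspose_mul_mul_same P
  have h2 := hM.posSemidef.conjTranspose_mul_mul_same (1 - P)
  rw [conjTranspose_sub, conjTranspose_one] at h2
  rw [hP] at h1 h2
  have e : star v ⬝ᵥ ((P * M * P) *ᵥ v) + star v ⬝ᵥ (((1 - P) * M * (1 - P)) *ᵥ v) = 0 := by
    rw [← dotProduct_add, ← add_mulVec]
    change star v ⬝ᵥ (Matrix.pinch P M *ᵥ v) = 0
    rw [hv0, dotProduct_zero]
  have key : ∀ Q : Matrix n n ℂ, Qᴴ = Q → star v ⬝ᵥ ((Q * M * Q) *ᵥ v) = 0 → Q *ᵥ v = 0 := by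
    intro Q hQ h
    by_contra hne
    have := hM.dotProduct_mulVec_pos hne
    rw [star_mulVec, hQ, ← dotProduct_mulVec, mulVec_mulVec, mulVec_mulVec, h] at this
    exact lt_irrefl _ this
  have n1 := h1.dotProduct_mulVec_nonneg v
  have n2 := h2.dotProduct_mulVec_nonneg v
  have z := (add_eq_zero_iff_of_nonneg n1 n2).1 e
  have k1 := key P hP z.1
  have k2 := key (1 - P) (by rw [conjTranspose_sub, conjTranspose_one, hP]) z.2
  rw [sub_mulVec, one_mulVec, k1, sub_zero] at k2
  exact hv k2

theorem commute_pinch {P : Matrix n n ℂ} (hPP : P * P = P) (M : Matrix n n ℂ) :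
    Commute P (pinch P M) := by
  have h2 : P * (1 - P) = 0 := by rw [mul_sub, hPP, mul_one, sub_self]
  have h3 : (1 - P) * P = 0 := by rw [sub_mul, hPP, one_mul, sub_self]
  rw [Commute, SemiconjBy, pinch, mul_add, add_mul]
  simp only [Matrix.mul_assoc, h3, hPP]
  simp only [← Matrix.mul_assoc, h2, hPP]
  simp

theorem trace_mul_pinch {P K : Matrix n n ℂ} (hPP : P * P = P) (hK : Commute P K)
    (M : Matrix n n ℂ) : (K * pinch P M).trace = (K * M).trace := by
  have : K * pinch P M = pinch P (K * M) := by
    simp only [pinch, mul_add]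
    have h' : Commute (1 - P) K := (Commute.one_left K).sub_left hK
    simp only [← Matrix.mul_assoc, ← hK.eq, ← h'.eq]
  rw [this, trace_pinch hPP]

theorem commute_nonsing_inv {P K : Matrix n n ℂ} (h : Commute P K) : Commute P K⁻¹ := by
  by_cases hK : IsUnit K.det
  · have h1 : K⁻¹ * (P * K) * K⁻¹ = K⁻¹ * (K * P) * K⁻¹ := by rw [h.eq]
    rw [Matrix.mul_assoc, Matrix.mul_assoc, mul_nonsing_inv _ hK, mul_one, ← Matrix.mul_assoc,
      nonsing_inv_mul _ hK, one_mul] at h1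
    exact h1.symm
  · rw [nonsing_inv_apply_not_isUnit _ hK]; exact Commute.zero_right _

/-- For a positive definite block matrix and a pinching compatible with the blocks, the ratio
`det M / det (pinch M)` is at most the same ratio for the corner `A`. After factoring out the
corners, this compares the determinants of the two Schur complements. -/
theorem det_mul_det_pinch_le {A : Matrix m m ℂ} {C : Matrix m n ℂ} {D : Matrix n n ℂ}
    {P : Matrix m m ℂ} {Q : Matrix n n ℂ} (hM : (fromBlocks A C Cᴴ D).PosDef)
    (hP : Pᴴ = P) (hPP : P * P = P) (hQ : Qᴴ = Q) (hQQ : Q * Q = Q) :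
    (fromBlocks A C Cᴴ D).det * (pinch P A).det ≤
      (pinch (fromBlocks P 0 0 Q) (fromBlocks A C Cᴴ D)).det * A.det := by
  have hA : A.PosDef := by
    have := hM.submatrix (e := Sum.inl) Sum.inl_injective
    exact this
  have hA' : (pinch P A).PosDef := hA.pinch hP
  set C' : Matrix m n ℂ := P * C * Q + (1 - P) * C * (1 - Q) with hC'
  have hpin : ∀ E : Matrix n n ℂ, pinch (fromBlocks P 0 0 Q) (fromBlocks A C Cᴴ E) =
      fromBlocks (pinch P A) C' C'ᴴ (pinch Q E) := by
    intro E
    have e : (1 : Matrix (m ⊕ n) (m ⊕ n) ℂ) - fromBlocks P 0 0 Q = fromBlocks (1 - P) 0 0 (1 - Q) := by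
      rw [← fromBlocks_one, sub_eq_add_neg, fromBlocks_neg, fromBlocks_add]
      simp [sub_eq_add_neg]
    rw [pinch, e]
    simp [fromBlocks_multiply, fromBlocks_add, pinch, hC', hP, hQ, Matrix.mul_assoc]
  let _ : Invertible A := hA.isUnit.invertible
  let _ : Invertible (pinch P A) := hA'.isUnit.invertible
  set S := D - Cᴴ * A⁻¹ * C with hS
  set S' := pinch Q D - C'ᴴ * (pinch P A)⁻¹ * C' with hS'
  have hPb : (fromBlocks P 0 0 Q)ᴴ = fromBlocks P 0 0 Q := by simp [fromBlocks_conjTranspose, hP, hQ]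
  have hPPb : fromBlocks P 0 0 Q * fromBlocks P 0 0 Q = fromBlocks P 0 0 Q := by
    simp [fromBlocks_multiply, hPP, hQQ]
  have hM' := hM.pinch hPb
  rw [hpin] at hM' ⊢
  have d1 : (fromBlocks A C Cᴴ D).det = A.det * S.det := by
    rw [det_fromBlocks₁₁, invOf_eq_nonsing_inv]
  have d2 : (fromBlocks (pinch P A) C' C'ᴴ (pinch Q D)).det = (pinch P A).det * S'.det := by
    rw [det_fromBlocks₁₁, invOf_eq_nonsing_inv]
  have hSp : S.PosDef := by
    refine ((PosDef.fromBlocks₁₁ C D hA).1 hM.posSemidef).posDef_iff_det_ne_zero.2 fun h0 => ?_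
    have := hM.det_pos
    rw [d1, hS, h0, mul_zero] at this
    exact lt_irrefl _ this
  have hSp' : S'.PosDef := by
    refine ((PosDef.fromBlocks₁₁ C' _ hA').1 hM'.posSemidef).posDef_iff_det_ne_zero.2 fun h0 => ?_
    have := hM'.det_pos
    rw [d2, hS', h0, mul_zero] at this
    exact lt_irrefl _ this
  -- subtracting the Schur complement keeps `M` positive semidefinite, and so does pinching: the
  -- Schur complement of the pinching dominates the pinching of the Schur complement
  have hle : (S' - pinch Q S).PosSemidef := by
    have h0 : (fromBlocks A C Cᴴ (D - S)).PosSemidef := by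
      rw [PosDef.fromBlocks₁₁ C _ hA, hS]
      simp [PosSemidef.zero]
    have h1 := h0.pinch hPb
    rw [hpin, PosDef.fromBlocks₁₁ C' _ hA'] at h1
    have e : S' - pinch Q S = pinch Q (D - S) - C'ᴴ * (pinch P A)⁻¹ * C' := by
      rw [hS']
      simp only [pinch, mul_sub, sub_mul]
      abel
    rwa [e]
  have hcomm : Commute Q S' := by
    have c1 : C' * Q = P * C' := by
      have z1 : (1 - Q) * Q = 0 := by rw [sub_mul, hQQ, one_mul, sub_self]
      have z2 : P * (1 - P) = 0 := by rw [mul_sub, hPP, mul_one, sub_self]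
      rw [hC', Matrix.add_mul, Matrix.mul_add, Matrix.mul_assoc _ Q Q, hQQ,
        Matrix.mul_assoc _ (1 - Q) Q, z1, ← Matrix.mul_assoc, ← Matrix.mul_assoc, hPP,
        ← Matrix.mul_assoc, ← Matrix.mul_assoc, z2]
      simp
    have c2 : Q * C'ᴴ = C'ᴴ * P := by
      have := congrArg conjTranspose c1
      simpa [hP, hQ] using this
    refine (commute_pinch hQQ D).sub_right ?_
    have c3 := (commute_nonsing_inv (commute_pinch hPP A)).eq
    rw [Commute, SemiconjBy, ← Matrix.mul_assoc, ← Matrix.mul_assoc, c2, Matrix.mul_assoc _ _ Q, c1,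
      ← Matrix.mul_assoc, Matrix.mul_assoc _ P, c3]
    simp only [Matrix.mul_assoc]
  have hdet : S.det ≤ S'.det := by
    refine hSp.det_le_det_of_trace_le hSp' ?_
    have h1 : 0 ≤ (S'⁻¹ * (S' - pinch Q S)).trace := by
      open scoped MatrixOrder in
      obtain ⟨R, hR⟩ : ∃ R : Matrix n n ℂ, S'⁻¹ = Rᴴ * R :=
        CStarAlgebra.nonneg_iff_eq_star_mul_self.1 (nonneg_iff_posSemidef.2 hSp'.inv.posSemidef)
      rw [hR, Matrix.mul_assoc, trace_mul_comm]
      exact (hle.mul_mul_conjTranspose_same R).trace_nonneg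
    rw [Matrix.mul_sub, trace_sub, trace_mul_pinch hQQ (commute_nonsing_inv hcomm),
      nonsing_inv_mul _ ((isUnit_iff_isUnit_det _).1 hSp'.isUnit), trace_one] at h1
    have := (Complex.le_def.1 h1).1
    simpa using this
  rw [d1, d2]
  have := mul_le_mul_of_nonneg_left hdet (mul_pos hA.det_pos hA'.det_pos).le
  calc _ = A.det * (pinch P A).det * S.det := by ring
    _ ≤ A.det * (pinch P A).det * S'.det := this
    _ = _ := by ring

theorem IsHermitian.det_add_smul_one {M : Matrix n n ℂ} (hM : M.IsHermitian) (t : ℝ) :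
    (M + (t : ℂ) • 1).det = ((∏ i, (hM.eigenvalues i + t) : ℝ) : ℂ) := by
  have h := eval_charpoly (-M) (t : ℂ)
  have h2 := congrArg (Polynomial.eval (-(t : ℂ))) hM.charpoly_eq
  rw [eval_charpoly, Polynomial.eval_prod] at h2
  simp only [Polynomial.eval_sub, Polynomial.eval_X, Polynomial.eval_C] at h2
  have e1 : M + (t : ℂ) • 1 = -(scalar n (-(t : ℂ)) - M) := by
    rw [map_neg]; simp [← smul_one_eq_diagonal]
  rw [e1, det_neg, h2, ← Finset.card_univ, ← Finset.prod_const, ← Finset.prod_mul_distrib]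
  push_cast
  exact Finset.prod_congr rfl fun i _ => by simp

/-- The trace inequality for matrices: `Tr (h(A) - h(pinch A)) ≤ Tr (h(M) - h(pinch M))` with
`h x = x log x`, for a corner `A` of a positive definite block matrix `M`. -/
theorem entropy_block_le {A : Matrix m m ℂ} {C : Matrix m n ℂ} {D : Matrix n n ℂ}
    {P : Matrix m m ℂ} {Q : Matrix n n ℂ} (hM : (fromBlocks A C Cᴴ D).PosDef)
    (hP : Pᴴ = P) (hPP : P * P = P) (hQ : Qᴴ = Q) (hQQ : Q * Q = Q)
    (hM' : (pinch (fromBlocks P 0 0 Q) (fromBlocks A C Cᴴ D)).IsHermitian)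
    (hA : A.IsHermitian) (hA' : (pinch P A).IsHermitian) :
    ∑ k, hA.eigenvalues k * Real.log (hA.eigenvalues k) -
        ∑ k, hA'.eigenvalues k * Real.log (hA'.eigenvalues k) ≤
      ∑ i, hM.isHermitian.eigenvalues i * Real.log (hM.isHermitian.eigenvalues i) -
        ∑ i, hM'.eigenvalues i * Real.log (hM'.eigenvalues i) := by
  have hPb : (fromBlocks P 0 0 Q)ᴴ = fromBlocks P 0 0 Q := by simp [fromBlocks_conjTranspose, hP, hQ]
  have hPPb : fromBlocks P 0 0 Q * fromBlocks P 0 0 Q = fromBlocks P 0 0 Q := by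
    simp [fromBlocks_multiply, hPP, hQQ]
  have pM' := hM.pinch hPb
  have pA : A.PosDef := hM.submatrix (e := Sum.inl) Sum.inl_injective
  have pA' := pA.pinch hP
  refine sum_mul_log_sub_le _ _ _ _ hM.eigenvalues_pos pM'.eigenvalues_pos pA.eigenvalues_pos
    pA'.eigenvalues_pos ?_ ?_ ?_
  · have := trace_pinch hPPb (fromBlocks A C Cᴴ D)
    rw [hM'.trace_eq_sum_eigenvalues, hM.isHermitian.trace_eq_sum_eigenvalues] at this
    exact_mod_cast this.symm
  · have := trace_pinch hPP A
    rw [hA'.trace_eq_sum_eigenvalues, hA.trace_eq_sum_eigenvalues] at this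
    exact_mod_cast this.symm
  · intro t ht
    have e : fromBlocks A C Cᴴ D + (t : ℂ) • 1 =
        fromBlocks (A + (t : ℂ) • 1) C Cᴴ (D + (t : ℂ) • 1) := by
      rw [← fromBlocks_one, fromBlocks_smul, fromBlocks_add]; simp
    have h := hM.add_smul_one ht
    rw [e] at h
    have := det_mul_det_pinch_le h hP hPP hQ hQQ
    rw [← e, pinch_add_smul_one hPP, pinch_add_smul_one hPPb,
      hM.isHermitian.det_add_smul_one, hA'.det_add_smul_one, hM'.det_add_smul_one,
      hA.det_add_smul_one] at this
    exact_mod_cast this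

end Matrix

/-! ### Hilbert–Schmidt operators and trace norm bounds -/

namespace TraceIneq

variable {H : Type*} [NormedAddCommGroup H] [InnerProductSpace ℂ H]

variable {ι : Type*} (b : HilbertBasis ι ℂ H)

theorem hasSum_norm_inner_sq (x : H) : HasSum (fun j => ‖⟪b j, x⟫_ℂ‖ ^ 2) (‖x‖ ^ 2) := by
  have h := (Complex.hasSum_re (b.hasSum_inner_mul_inner x x))
  have e : (⟪x, x⟫_ℂ).re = ‖x‖ ^ 2 := by
    rw [inner_self_eq_norm_sq_to_K]; norm_cast
  rw [e] at h
  refine h.congr_fun fun j => ?_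
  have h2 : (⟪x, b j⟫_ℂ * ⟪b j, x⟫_ℂ).re = ‖⟪x, b j⟫_ℂ * ⟪b j, x⟫_ℂ‖ :=
    inner_mul_symm_re_eq_norm (𝕜 := ℂ) x (b j)
  rw [h2, norm_mul, norm_inner_symm x (b j), sq]

/-- `K` is Hilbert–Schmidt along the Hilbert basis `b`: `∑ ‖K b i‖² < ∞`. -/
def IsHilbertSchmidt (K : H →L[ℂ] H) : Prop := Summable fun i => ‖K (b i)‖ ^ 2

variable {b}

theorem IsHilbertSchmidt.summable_prod {K : H →L[ℂ] H} (hK : IsHilbertSchmidt b K) :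
    Summable fun x : ι × ι => ‖⟪b x.2, K (b x.1)⟫_ℂ‖ ^ 2 := by
  rw [summable_prod_of_nonneg (fun x => by positivity)]
  refine ⟨fun i => (hasSum_norm_inner_sq b (K (b i))).summable, ?_⟩
  exact hK.congr fun i => ((hasSum_norm_inner_sq b (K (b i))).tsum_eq).symm

theorem IsHilbertSchmidt.mul_left {K : H →L[ℂ] H} (hK : IsHilbertSchmidt b K) (L : H →L[ℂ] H) :
    IsHilbertSchmidt b (L * K) ∧
      ∑' i, ‖(L * K) (b i)‖ ^ 2 ≤ ‖L‖ ^ 2 * ∑' i, ‖K (b i)‖ ^ 2 := by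
  have hle : ∀ i, ‖(L * K) (b i)‖ ^ 2 ≤ ‖L‖ ^ 2 * ‖K (b i)‖ ^ 2 := fun i => by
    rw [← mul_pow]
    exact pow_le_pow_left₀ (norm_nonneg _) (L.le_opNorm _) 2
  have h1 : IsHilbertSchmidt b (L * K) :=
    Summable.of_nonneg_of_le (fun i => by positivity) hle (Summable.mul_left _ hK)
  refine ⟨h1, ?_⟩
  rw [← tsum_mul_left]
  exact Summable.tsum_le_tsum hle h1 (Summable.mul_left _ hK)

variable (b) in
/-- A bound for the trace norm of `R`, tested along the orthonormal basis `b`: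
`∑ |⟨V b i, R b i⟩| ≤ C` over finite sets of indices, for every contraction `V`. -/
def TraceBound (R : H →L[ℂ] H) (C : ℝ) : Prop :=
  ∀ V : H →L[ℂ] H, ‖V‖ ≤ 1 → ∀ s : Finset ι, ∑ i ∈ s, ‖⟪V (b i), R (b i)⟫_ℂ‖ ≤ C

theorem TraceBound.summable {R : H →L[ℂ] H} {C : ℝ} (h : TraceBound b R C) :
    Summable fun i => ‖⟪b i, R (b i)⟫_ℂ‖ :=
  summable_of_sum_le (fun _ => norm_nonneg _)
    (fun s => by simpa using h 1 ContinuousLinearMap.norm_id_le s)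

theorem TraceBound.tsum_norm_le {R : H →L[ℂ] H} {C : ℝ} (h : TraceBound b R C) :
    ∑' i, ‖⟪b i, R (b i)⟫_ℂ‖ ≤ C :=
  h.summable.tsum_le_of_sum_le (fun s => by simpa using h 1 ContinuousLinearMap.norm_id_le s)

theorem TraceBound.smul {R : H →L[ℂ] H} {C : ℝ} (h : TraceBound b R C) (c : ℂ) :
    TraceBound b (c • R) (‖c‖ * C) := by
  intro V hV s
  simp only [smul_apply, inner_smul_right, norm_mul, ← Finset.mul_sum]
  exact mul_le_mul_of_nonneg_left (h V hV s) (norm_nonneg _)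

theorem TraceBound.sum {κ : Type*} {t : Finset κ} {R : κ → H →L[ℂ] H} {C : κ → ℝ}
    (h : ∀ k ∈ t, TraceBound b (R k) (C k)) : TraceBound b (∑ k ∈ t, R k) (∑ k ∈ t, C k) := by
  intro V hV s
  calc ∑ i ∈ s, ‖⟪V (b i), (∑ k ∈ t, R k) (b i)⟫_ℂ‖
      ≤ ∑ i ∈ s, ∑ k ∈ t, ‖⟪V (b i), R k (b i)⟫_ℂ‖ := by
        refine Finset.sum_le_sum fun i _ => ?_
        rw [sum_apply, inner_sum]
        exact norm_sum_le _ _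
    _ = ∑ k ∈ t, ∑ i ∈ s, ‖⟪V (b i), R k (b i)⟫_ℂ‖ := Finset.sum_comm
    _ ≤ _ := Finset.sum_le_sum fun k hk => h k hk V hV s

theorem TraceBound.mono {R : H →L[ℂ] H} {C C' : ℝ} (h : TraceBound b R C) (hC : C ≤ C') :
    TraceBound b R C' := fun V hV s => (h V hV s).trans hC

/-- A norm-convergent series whose terms have summable trace bounds has a trace bound, and its trace
can be computed termwise. -/
theorem TraceBound.hasSum {Z : ℕ → H →L[ℂ] H} {R : H →L[ℂ] H} {C : ℕ → ℝ} (hZ : HasSum Z R)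
    (h : ∀ k, TraceBound b (Z k) (C k)) (hC : Summable C) :
    TraceBound b R (∑' k, C k) ∧
      ∑' i, ⟪b i, R (b i)⟫_ℂ = ∑' k, ∑' i, ⟪b i, Z k (b i)⟫_ℂ := by
  have hin : ∀ x y : H, HasSum (fun k => ⟪x, Z k y⟫_ℂ) ⟪x, R y⟫_ℂ := fun x y =>
    hZ.mapL ((innerSL ℂ x).comp (ContinuousLinearMap.apply ℂ H y))
  have hC0 : ∀ k, 0 ≤ C k := fun k => by simpa using h k 0 (by simp) ∅
  refine ⟨fun V hV s => ?_, ?_⟩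
  · have ht : Filter.Tendsto (fun t : Finset ℕ =>
        ∑ i ∈ s, ‖⟪V (b i), (∑ k ∈ t, Z k) (b i)⟫_ℂ‖) Filter.atTop
        (nhds (∑ i ∈ s, ‖⟪V (b i), R (b i)⟫_ℂ‖)) := by
      refine tendsto_finsetSum _ fun i _ => ?_
      refine Filter.Tendsto.norm ((hin (V (b i)) (b i)).congr fun t => ?_)
      rw [sum_apply, inner_sum]
    refine le_of_tendsto ht (Filter.Eventually.of_forall fun t => ?_)
    exact (TraceBound.sum (fun k _ => h k) V hV s).trans (hC.sum_le_tsum t fun k _ => hC0 k)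
  · have hs : Summable fun x : ℕ × ι => ⟪b x.2, Z x.1 (b x.2)⟫_ℂ := by
      refine Summable.of_norm ?_
      rw [summable_prod_of_nonneg (fun x => norm_nonneg _)]
      exact ⟨fun k => (h k).summable, Summable.of_nonneg_of_le
        (fun k => tsum_nonneg fun i => norm_nonneg _) (fun k => (h k).tsum_norm_le) hC⟩
    rw [← hs.tsum_comm (f := fun k i => ⟪b i, Z k (b i)⟫_ℂ)]
    exact tsum_congr fun i => (hin _ _).tsum_eq.symm

variable [CompleteSpace H]

theorem norm_inner_adjoint_swap (K : H →L[ℂ] H) (i j : ι) :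
    ‖⟪b i, star K (b j)⟫_ℂ‖ = ‖⟪b j, K (b i)⟫_ℂ‖ := by
  rw [ContinuousLinearMap.star_eq_adjoint, ContinuousLinearMap.adjoint_inner_right,
    norm_inner_symm]

theorem IsHilbertSchmidt.adjoint {K : H →L[ℂ] H} (hK : IsHilbertSchmidt b K) :
    IsHilbertSchmidt b (star K) ∧ ∑' i, ‖star K (b i)‖ ^ 2 = ∑' i, ‖K (b i)‖ ^ 2 := by
  have hp := hK.summable_prod
  have hs : Summable fun x : ι × ι => ‖⟪b x.2, star K (b x.1)⟫_ℂ‖ ^ 2 := by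
    refine ((Equiv.prodComm ι ι).summable_iff.2 hp).congr fun x => ?_
    simp [norm_inner_adjoint_swap]
  have e : ∀ (L : H →L[ℂ] H) i, ‖L (b i)‖ ^ 2 = ∑' j, ‖⟪b j, L (b i)⟫_ℂ‖ ^ 2 :=
    fun L i => (hasSum_norm_inner_sq b (L (b i))).tsum_eq.symm
  refine ⟨?_, ?_⟩
  · unfold IsHilbertSchmidt
    simp only [e]
    exact hs.prod
  · simp only [e]
    have := hp.tsum_comm (f := fun i j => ‖⟪b j, K (b i)⟫_ℂ‖ ^ 2)
    rw [← this]
    simp only [norm_inner_adjoint_swap]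

theorem IsHilbertSchmidt.mul_right {K : H →L[ℂ] H} (hK : IsHilbertSchmidt b K) (L : H →L[ℂ] H) :
    IsHilbertSchmidt b (K * L) ∧
      ∑' i, ‖(K * L) (b i)‖ ^ 2 ≤ ‖L‖ ^ 2 * ∑' i, ‖K (b i)‖ ^ 2 := by
  have h1 := hK.adjoint
  have h2 := h1.1.mul_left (Star.star L)
  have h3 := h2.1.adjoint
  rw [star_mul, star_star, star_star] at h3
  refine ⟨h3.1, ?_⟩
  rw [h3.2, ← h1.2, ← norm_star L]
  exact h2.2

/-- Cyclicity of the trace for a product of two Hilbert–Schmidt operators. -/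
theorem IsHilbertSchmidt.tsum_inner_mul_comm {K N : H →L[ℂ] H} (hK : IsHilbertSchmidt b K)
    (hN : IsHilbertSchmidt b N) :
    ∑' i, ⟪b i, (K * N) (b i)⟫_ℂ = ∑' i, ⟪b i, (N * K) (b i)⟫_ℂ := by
  have e : ∀ (K N : H →L[ℂ] H) i, ⟪b i, (K * N) (b i)⟫_ℂ =
      ∑' j, ⟪b i, K (b j)⟫_ℂ * ⟪b j, N (b i)⟫_ℂ := by
    intro K N i
    have := b.tsum_inner_mul_inner (Star.star K (b i)) (N (b i))
    simp only [ContinuousLinearMap.star_eq_adjoint, ContinuousLinearMap.adjoint_inner_left] at this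
    exact this.symm
  have hs : Summable fun x : ι × ι => ⟪b x.1, K (b x.2)⟫_ℂ * ⟪b x.2, N (b x.1)⟫_ℂ := by
    refine Summable.of_norm_bounded
      (((Equiv.prodComm ι ι).summable_iff.2 hK.summable_prod).add hN.summable_prod) fun x => ?_
    simp only [Function.comp, Equiv.prodComm_apply, Prod.fst_swap, Prod.snd_swap, norm_mul]
    nlinarith [sq_nonneg (‖⟪b x.1, K (b x.2)⟫_ℂ‖ - ‖⟪b x.2, N (b x.1)⟫_ℂ‖),
      sq_nonneg (‖⟪b x.1, K (b x.2)⟫_ℂ‖), sq_nonneg (‖⟪b x.2, N (b x.1)⟫_ℂ‖)]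
  simp only [e]
  rw [← hs.tsum_comm (f := fun i j => ⟪b i, K (b j)⟫_ℂ * ⟪b j, N (b i)⟫_ℂ)]
  simp only [mul_comm]

/-- The trace norm of `L K* N R` is at most `‖L‖ ‖R‖ c`, for any common bound `c` of the squared
Hilbert–Schmidt norms of `K` and `N`. -/
theorem traceBound_mul_mul {K N : H →L[ℂ] H} (hK : IsHilbertSchmidt b K)
    (hN : IsHilbertSchmidt b N) (L R : H →L[ℂ] H) {c : ℝ}
    (hKc : ∑' i, ‖K (b i)‖ ^ 2 ≤ c) (hNc : ∑' i, ‖N (b i)‖ ^ 2 ≤ c) :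
    TraceBound b (L * (star K * N) * R) (‖L‖ * ‖R‖ * c) := by
  intro V hV s
  have hc : 0 ≤ c := (tsum_nonneg fun i => by positivity).trans hKc
  have h1 := hK.mul_right (star L * V)
  have h2 := hN.mul_right R
  have b1 : ∑ i ∈ s, ‖(K * (star L * V)) (b i)‖ ^ 2 ≤ ‖L‖ ^ 2 * c := by
    refine (h1.1.sum_le_tsum s fun i _ => by positivity).trans (h1.2.trans ?_)
    have : ‖star L * V‖ ≤ ‖L‖ := by
      refine (norm_mul_le _ _).trans ?_
      rw [norm_star]
      exact mul_le_of_le_one_right (norm_nonneg _) hV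
    gcongr
  have b2 : ∑ i ∈ s, ‖(N * R) (b i)‖ ^ 2 ≤ ‖R‖ ^ 2 * c := by
    refine (h2.1.sum_le_tsum s fun i _ => by positivity).trans (h2.2.trans ?_)
    gcongr
  calc ∑ i ∈ s, ‖⟪V (b i), (L * (star K * N) * R) (b i)⟫_ℂ‖
      ≤ ∑ i ∈ s, ‖(K * (star L * V)) (b i)‖ * ‖(N * R) (b i)‖ := by
        refine Finset.sum_le_sum fun i _ => ?_
        have : ⟪V (b i), (L * (star K * N) * R) (b i)⟫_ℂ =
            ⟪(K * (star L * V)) (b i), (N * R) (b i)⟫_ℂ := by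
          simp only [mul_apply_eq_comp, ContinuousLinearMap.star_eq_adjoint]
          rw [← ContinuousLinearMap.adjoint_inner_left, ContinuousLinearMap.adjoint_inner_right]
        rw [this]
        exact norm_inner_le_norm _ _
    _ ≤ √(∑ i ∈ s, ‖(K * (star L * V)) (b i)‖ ^ 2) * √(∑ i ∈ s, ‖(N * R) (b i)‖ ^ 2) :=
        Real.sum_mul_le_sqrt_mul_sqrt _ _ _
    _ ≤ √(‖L‖ ^ 2 * c) * √(‖R‖ ^ 2 * c) := by gcongr
    _ = ‖L‖ * ‖R‖ * c := by
        rw [Real.sqrt_mul (by positivity), Real.sqrt_mul (by positivity),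
          Real.sqrt_sq (norm_nonneg _), Real.sqrt_sq (norm_nonneg _)]
        have := Real.mul_self_sqrt hc
        linear_combination ‖L‖ * ‖R‖ * this

/-- A self-adjoint operator `T` is a product `S Q` of self-adjoint operators with
`S² = Q² = |T|`: take `S = |T|^{1/2}` and `Q = sgn(T) |T|^{1/2}`. The function `sgn(x) |x|^{1/2}` is
continuous, so no polar decomposition is needed. -/
theorem exists_selfAdjoint_factors {T : H →L[ℂ] H} (hT : IsSelfAdjoint T) :
    ∃ S Q : H →L[ℂ] H, IsSelfAdjoint S ∧ IsSelfAdjoint Q ∧ T = S * Q ∧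
      S * S = CFC.abs T ∧ Q * Q = CFC.abs T := by
  set f : ℝ → ℝ := fun x => √(max x 0) + √(max (-x) 0) with hf
  set g : ℝ → ℝ := fun x => √(max x 0) - √(max (-x) 0) with hg
  have cf : Continuous f := by fun_prop
  have cg : Continuous g := by fun_prop
  have key : ∀ x : ℝ, f x * g x = x ∧ f x * f x = ‖x‖ ∧ g x * g x = ‖x‖ := by
    intro x
    have h1 := Real.mul_self_sqrt (le_max_right x 0)
    have h2 := Real.mul_self_sqrt (le_max_right (-x) 0)
    rcases le_total 0 x with h | h
    · have e1 : max x 0 = x := max_eq_left h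
      have e2 : max (-x) 0 = 0 := max_eq_right (by linarith)
      simp only [hf, hg, e1, e2, Real.sqrt_zero, add_zero, sub_zero, Real.mul_self_sqrt h,
        Real.norm_of_nonneg h, and_self]
    · have e1 : max x 0 = 0 := max_eq_right h
      have e2 : max (-x) 0 = -x := max_eq_left (by linarith)
      have h3 := Real.mul_self_sqrt (neg_nonneg.2 h)
      simp only [hf, hg, e1, e2, Real.sqrt_zero, zero_add, zero_sub, Real.norm_of_nonpos h]
      refine ⟨by linarith, by linarith, by linarith⟩
  refine ⟨cfc f T, cfc g T, cfc_predicate _ _, cfc_predicate _ _, ?_, ?_, ?_⟩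
  · rw [← cfc_mul f g T cf.continuousOn cg.continuousOn]
    simp only [key]
    exact (cfc_id' ℝ T).symm
  · rw [← cfc_mul f f T cf.continuousOn cf.continuousOn, CFC.abs_eq_cfc_norm T]
    simp only [key]
  · rw [← cfc_mul g g T cg.continuousOn cg.continuousOn, CFC.abs_eq_cfc_norm T]
    simp only [key]

/-- A trace bound for `R` makes the diagonal of `|R|` summable. The contractions
`R (|R| + δ)⁻¹` replace the partial isometry of the polar decomposition, at a cost of at most `δ`
per basis vector. -/
theorem TraceBound.summable_abs {R : H →L[ℂ] H} {C : ℝ} (h : TraceBound b R C) :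
    Summable fun i => (⟪b i, CFC.abs R (b i)⟫_ℂ).re := by
  have habs : 0 ≤ CFC.abs R := CFC.abs_nonneg R
  have hsa : IsSelfAdjoint (CFC.abs R) := habs.isSelfAdjoint
  have hnn : ∀ x : H, 0 ≤ (⟪x, CFC.abs R x⟫_ℂ).re := fun x =>
    ((ContinuousLinearMap.nonneg_iff_isPositive _).1 habs).re_inner_nonneg_right x
  refine summable_of_sum_le (c := C) (fun i => hnn _) fun s => ?_
  have main : ∀ δ : ℝ, 0 < δ →
      ∑ i ∈ s, (⟪b i, CFC.abs R (b i)⟫_ℂ).re ≤ C + s.card * δ := by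
    intro δ hδ
    have hpos : ∀ x ∈ spectrum ℝ (CFC.abs R), 0 ≤ x := fun x hx => spectrum_nonneg_of_nonneg habs hx
    have cont : ContinuousOn (fun x : ℝ => (x + δ)⁻¹) (spectrum ℝ (CFC.abs R)) :=
      ContinuousOn.inv₀ (by fun_prop) fun x hx => by have := hpos x hx; positivity
    set J := cfc (fun x : ℝ => (x + δ)⁻¹) (CFC.abs R) with hJ
    have hJsa : IsSelfAdjoint J := cfc_predicate _ _
    have hRR : star R * R = CFC.abs R * CFC.abs R := (CFC.abs_mul_abs R).symm
    have hJR : CFC.abs R * J = cfc (fun x : ℝ => x * (x + δ)⁻¹) (CFC.abs R) := by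
      rw [cfc_mul (fun x : ℝ => x) _ _ (by fun_prop) cont, cfc_id' ℝ (CFC.abs R)]
    have hV : ‖R * J‖ ≤ 1 := by
      have h1 : ‖R * J‖ * ‖R * J‖ = ‖CFC.abs R * J‖ * ‖CFC.abs R * J‖ := by
        rw [← CStarRing.norm_star_mul_self, ← CStarRing.norm_star_mul_self, star_mul, star_mul,
          hsa.star_eq, mul_assoc, ← mul_assoc (star R), hRR]
        simp only [mul_assoc]
      have h2 : ‖R * J‖ = ‖CFC.abs R * J‖ := by
        exact (mul_self_inj (norm_nonneg _) (norm_nonneg _)).1 h1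
      rw [h2, hJR]
      refine norm_cfc_le zero_le_one fun x hx => ?_
      have := hpos x hx
      rw [Real.norm_of_nonneg (by positivity), ← div_eq_mul_inv]
      exact div_le_one_of_le₀ (by linarith) (by positivity)
    have hle : CFC.abs R ≤ star (R * J) * R + algebraMap ℝ _ δ := by
      rw [star_mul, hJsa.star_eq, mul_assoc, hRR]
      have e : J * (CFC.abs R * CFC.abs R) + algebraMap ℝ _ δ =
          cfc (fun x : ℝ => (x + δ)⁻¹ * (x * x) + δ) (CFC.abs R) := by
        rw [cfc_add _ (fun x : ℝ => (x + δ)⁻¹ * (x * x)) (fun _ => δ) (cont.mul (by fun_prop))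
          (by fun_prop), cfc_const δ (CFC.abs R), cfc_mul _ (fun x : ℝ => x * x) _ cont (by fun_prop),
          cfc_mul (fun x : ℝ => x) (fun x : ℝ => x) _ (by fun_prop) (by fun_prop),
          cfc_id' ℝ (CFC.abs R)]
      rw [e]
      conv_lhs => rw [← cfc_id' ℝ (CFC.abs R)]
      refine cfc_mono (fun x hx => ?_) (by fun_prop)
        ((cont.mul (by fun_prop)).add (by fun_prop))
      have := hpos x hx
      have h3 : (x + δ)⁻¹ * (x * x) + δ - x = δ ^ 2 * (x + δ)⁻¹ := by field_simp; ring
      have : 0 ≤ δ ^ 2 * (x + δ)⁻¹ := by positivity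
      linarith
    have hle' := (ContinuousLinearMap.le_def _ _).1 hle
    calc ∑ i ∈ s, (⟪b i, CFC.abs R (b i)⟫_ℂ).re
        ≤ ∑ i ∈ s, (‖⟪(R * J) (b i), R (b i)⟫_ℂ‖ + δ) := by
          refine Finset.sum_le_sum fun i _ => ?_
          have h1 := hle'.re_inner_nonneg_right (b i)
          rw [sub_apply, add_apply, inner_sub_right,
            inner_add_right, mul_apply_eq_comp (star (R * J)),
            ContinuousLinearMap.star_eq_adjoint, ContinuousLinearMap.adjoint_inner_right] at h1
          have h2 : ⟪b i, (algebraMap ℝ (H →L[ℂ] H) δ) (b i)⟫_ℂ = δ := by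
            rw [Algebra.algebraMap_eq_smul_one, smul_apply,
              one_apply_eq_self, inner_smul_right_eq_smul,
              inner_self_eq_norm_sq_to_K, b.orthonormal.1]
            simp
          rw [h2] at h1
          have h3 := Complex.re_le_norm ⟪(R * J) (b i), R (b i)⟫_ℂ
          simp at h1 h3 ⊢
          linarith
      _ = ∑ i ∈ s, ‖⟪(R * J) (b i), R (b i)⟫_ℂ‖ + s.card * δ := by
          rw [Finset.sum_add_distrib, Finset.sum_const, nsmul_eq_mul]
      _ ≤ _ := by gcongr; exact h _ hV s
  refine le_of_forall_pos_le_add fun η hη => ?_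
  have := main (η / (s.card + 1)) (by positivity)
  refine this.trans ?_
  have h3 : (s.card : ℝ) * (η / (s.card + 1)) ≤ η := by
    rw [mul_div_assoc', div_le_iff₀ (by positivity)]
    nlinarith
  linarith

end TraceIneq

/-! ### The logarithm of a compression -/

namespace TraceIneq

variable {H : Type*} [NormedAddCommGroup H] [InnerProductSpace ℂ H] [CompleteSpace H]

theorem isSelfAdjoint_of_smul_one_le {A : H →L[ℂ] H} {ε : ℝ} (hε : 0 < ε)
    (hA : ε • (1 : H →L[ℂ] H) ≤ A) : IsSelfAdjoint A ∧ 0 ≤ A := by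
  have h : 0 ≤ A := (smul_nonneg hε.le zero_le_one).trans hA
  exact ⟨h.isSelfAdjoint, h⟩

theorem isSelfAdjoint_compr {A p : H →L[ℂ] H} (hA : IsSelfAdjoint A) (hp : IsStarProjection p) :
    IsSelfAdjoint (compr p A) := by
  have := hA.conjugate p
  rwa [hp.isSelfAdjoint.star_eq] at this

theorem mul_compr {p : H →L[ℂ] H} (hp : IsStarProjection p) (A : H →L[ℂ] H) :
    p * compr p A = compr p A := by
  rw [compr, ← mul_assoc, ← mul_assoc, hp.isIdempotentElem.eq]

theorem compr_mul {p : H →L[ℂ] H} (hp : IsStarProjection p) (A : H →L[ℂ] H) :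
    compr p A * p = compr p A := by
  rw [compr, mul_assoc, hp.isIdempotentElem.eq]

theorem norm_le_one_of_isStarProjection {p : H →L[ℂ] H} (hp : IsStarProjection p) : ‖p‖ ≤ 1 := by
  have h1 : ‖p‖ * ‖p‖ = ‖p‖ := by
    rw [← CStarRing.norm_star_mul_self, hp.isSelfAdjoint.star_eq, hp.isIdempotentElem.eq]
  nlinarith [norm_nonneg p]

theorem norm_compr_le {p : H →L[ℂ] H} (hp : IsStarProjection p) (A : H →L[ℂ] H) :
    ‖compr p A‖ ≤ ‖A‖ := by
  have h := norm_le_one_of_isStarProjection hp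
  calc ‖p * A * p‖ ≤ ‖p‖ * ‖A‖ * ‖p‖ := (norm_mul_le _ _).trans (by gcongr; exact norm_mul_le _ _)
    _ ≤ 1 * ‖A‖ * 1 := by gcongr
    _ = ‖A‖ := by ring

theorem compr_nonneg {p A : H →L[ℂ] H} (hp : IsStarProjection p) (hA : 0 ≤ A) :
    0 ≤ compr p A := by
  have := star_left_conjugate_nonneg hA p
  rwa [hp.isSelfAdjoint.star_eq] at this

theorem compr_one {p : H →L[ℂ] H} (hp : IsStarProjection p) : compr p 1 = p := by
  rw [compr, mul_one, hp.isIdempotentElem.eq]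

/-- The spectrum of `p A p` has a gap `(0, ε)`, because
`(p A p)² - ε p A p = p A p (p A p - ε p)` is a product of commuting nonnegative operators. -/
theorem spectrum_compr_subset {A p : H →L[ℂ] H} {ε M : ℝ} (hε : 0 < ε)
    (hA : ε • (1 : H →L[ℂ] H) ≤ A) (hM : ‖A‖ ≤ M) (hp : IsStarProjection p) {x : ℝ}
    (hx : x ∈ spectrum ℝ (compr p A)) : x = 0 ∨ (ε ≤ x ∧ x ≤ M) := by
  have hA0 := isSelfAdjoint_of_smul_one_le hε hA
  have ha := isSelfAdjoint_compr hA0.1 hp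
  have hn := compr_nonneg hp hA0.2
  have hx0 : 0 ≤ x := spectrum_nonneg_of_nonneg hn hx
  have h1 : 0 ≤ compr p A - ε • p := by
    have h := compr_nonneg hp (sub_nonneg.2 hA)
    have e : compr p (A - ε • 1) = compr p A - ε • p := by
      simp only [compr, mul_sub, sub_mul, mul_smul_comm, smul_mul_assoc, mul_one,
        hp.isIdempotentElem.eq]
    rwa [e] at h
  have hc : Commute (compr p A) (compr p A - ε • p) := by
    refine (Commute.refl _).sub_right (Commute.smul_right ?_ _)
    rw [Commute, SemiconjBy, mul_compr hp, compr_mul hp]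
  have h2 : 0 ≤ cfc (fun x : ℝ => x * x - ε * x) (compr p A) := by
    have h := Commute.mul_nonneg hn h1 hc
    rw [mul_sub, mul_smul_comm, compr_mul hp] at h
    rw [cfc_sub (fun x : ℝ => x * x) (fun x => ε * x) (compr p A),
      cfc_mul (fun x : ℝ => x) (fun x : ℝ => x), cfc_const_mul_id ε (compr p A), cfc_id' ℝ (compr p A)]
    exact h
  have h3 := (cfc_nonneg_iff _ _).1 h2 x hx
  have h4 : x ≤ M := by
    have := (spectrum.norm_le_norm_mul_of_mem hx).trans
      (mul_le_of_le_one_right (norm_nonneg _) ContinuousLinearMap.norm_id_le)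
    rw [Real.norm_of_nonneg hx0] at this
    exact this.trans ((norm_compr_le hp A).trans hM)
  rcases hx0.eq_or_lt with h | h
  · exact Or.inl h.symm
  · refine Or.inr ⟨?_, h4⟩
    by_contra hlt
    push Not at hlt
    nlinarith

/-- The indicator function of the nonzero reals. Applied to `p A p` with `A ≥ ε > 0`, it gives `p`. -/
noncomputable def ind (x : ℝ) : ℝ := if x = 0 then 0 else 1

theorem continuousOn_of_isolated_zero {s : Set ℝ} {ε : ℝ} (hε : 0 < ε)
    (hs : ∀ x ∈ s, x = 0 ∨ ε ≤ x) {f : ℝ → ℝ} (hf : ContinuousOn f (Set.Ioi 0)) :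
    ContinuousOn f s := by
  intro x hx
  rcases hs x hx with rfl | h
  · refine (continuousWithinAt_const (b := f 0)).congr_of_eventuallyEq ?_ rfl
    filter_upwards [self_mem_nhdsWithin, mem_nhdsWithin_of_mem_nhds (gt_mem_nhds hε)] with y hy hyε
    rcases hs y hy with rfl | h
    · rfl
    · exact absurd h (not_le.2 hyε)
  · exact (hf.continuousAt (Ioi_mem_nhds (hε.trans_le h))).continuousWithinAt

theorem continuousOn_ind_Ioi : ContinuousOn ind (Set.Ioi 0) :=
  (continuousOn_const (c := (1 : ℝ))).congr fun x hx => by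
    simp [ind, (Set.mem_Ioi.1 hx).ne']

section Gap

variable {A p : H →L[ℂ] H} {ε : ℝ}

theorem continuousOn_spectrum_compr (hε : 0 < ε) (hA : ε • (1 : H →L[ℂ] H) ≤ A)
    (hp : IsStarProjection p) {f : ℝ → ℝ} (hf : ContinuousOn f (Set.Ioi 0)) :
    ContinuousOn f (spectrum ℝ (compr p A)) :=
  continuousOn_of_isolated_zero hε (fun _ hx =>
    (spectrum_compr_subset hε hA le_rfl hp hx).imp id And.left) hf

/-- The support projection of `p A p` is `p`: both `χ(p A p)` and `p` turn the invertible operator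
`p A p + ε (1 - p)` into `p A p`. -/
theorem cfc_ind_compr (hε : 0 < ε) (hA : ε • (1 : H →L[ℂ] H) ≤ A) (hp : IsStarProjection p) :
    cfc ind (compr p A) = p := by
  have ha := isSelfAdjoint_compr (isSelfAdjoint_of_smul_one_le hε hA).1 hp
  have cind := continuousOn_spectrum_compr hε hA hp continuousOn_ind_Ioi
  have cinv := continuousOn_spectrum_compr hε hA hp (f := fun x => x⁻¹)
    (continuousOn_inv₀.mono fun x hx => (Set.mem_Ioi.1 hx).ne')
  set a := compr p A with hadef
  have h1 : cfc ind a * a = a := by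
    conv_lhs => rw [← cfc_id' ℝ a]
    conv_lhs => enter [1]; rw [cfc_id' ℝ a]
    rw [← cfc_mul ind (fun x : ℝ => x) a cind (by fun_prop)]
    conv_rhs => rw [← cfc_id' ℝ a]
    refine cfc_congr fun x _ => ?_
    by_cases hx : x = 0 <;> simp [ind, hx]
  have h2 : cfc ind a * (1 - p) = 0 := by
    have e : cfc ind a = cfc (fun x : ℝ => x⁻¹) a * a := by
      conv_rhs => enter [2]; rw [← cfc_id' ℝ a]
      rw [← cfc_mul (fun x : ℝ => x⁻¹) (fun x : ℝ => x) a cinv (by fun_prop)]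
      refine cfc_congr fun x _ => ?_
      by_cases hx : x = 0 <;> simp [ind, hx]
    rw [e, mul_assoc, mul_sub, mul_one, hadef, compr_mul hp, sub_self, mul_zero]
  set N := a + ε • (1 - p) with hN
  have hNu : IsUnit N := by
    have hle : ε • (1 : H →L[ℂ] H) ≤ N := by
      have h := compr_nonneg hp (sub_nonneg.2 hA)
      have e : compr p (A - ε • 1) = N - ε • 1 := by
        rw [hN, smul_sub, add_sub_assoc, sub_sub_cancel_left, ← sub_eq_add_neg, hadef]
        conv_rhs => rw [← compr_one hp]
        simp only [compr, mul_sub, sub_mul, mul_smul_comm, smul_mul_assoc, mul_one,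
          hp.isIdempotentElem.eq]
      rw [e] at h
      exact sub_nonneg.1 h
    refine CStarAlgebra.isUnit_of_le (ε • (1 : H →L[ℂ] H)) hle ?_
    have : IsUnit (ε • (1 : H →L[ℂ] H)) := by
      rw [← Algebra.algebraMap_eq_smul_one]
      exact (IsUnit.mk0 ε hε.ne').map _
    exact IsStrictlyPositive.iff_of_unital.2 ⟨smul_nonneg hε.le zero_le_one, this⟩
  have h3 : (cfc ind a - p) * N = 0 := by
    rw [sub_mul, hN, mul_add, mul_add, h1, mul_smul_comm, mul_smul_comm, h2, hadef, mul_compr hp,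
      mul_sub, hp.isIdempotentElem.eq, mul_one, sub_self]
    simp
  exact sub_eq_zero.1 ((hNu.mul_left_eq_zero).1 h3)

theorem sub_smul_compr_eq_cfc (hε : 0 < ε) (hA : ε • (1 : H →L[ℂ] H) ≤ A)
    (hp : IsStarProjection p) (c : ℝ) :
    p - c • compr p A = cfc (fun x => ind x - c * x) (compr p A) := by
  have ha := isSelfAdjoint_compr (isSelfAdjoint_of_smul_one_le hε hA).1 hp
  rw [cfc_sub ind (fun x : ℝ => c * x) _
    (continuousOn_spectrum_compr hε hA hp continuousOn_ind_Ioi) (by fun_prop),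
    cfc_ind_compr hε hA hp, cfc_const_mul_id c (compr p A)]

theorem abs_ind_sub_le {M : ℝ} (hε : 0 < ε) (hA : ε • (1 : H →L[ℂ] H) ≤ A) (hM : ‖A‖ ≤ M)
    (hεM : ε ≤ M) (hp : IsStarProjection p) {x : ℝ} (hx : x ∈ spectrum ℝ (compr p A)) :
    |ind x - M⁻¹ * x| ≤ 1 - ε / M := by
  have hM0 : 0 < M := hε.trans_le hεM
  have h1 : ε / M ≤ 1 := (div_le_one hM0).2 hεM
  rcases spectrum_compr_subset hε hA hM hp hx with rfl | ⟨hl, hu⟩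
  · simpa [ind] using h1
  · have hx0 : x ≠ 0 := (hε.trans_le hl).ne'
    have h2 : x / M ≤ 1 := (div_le_one hM0).2 hu
    have h3 : ε / M ≤ x / M := div_le_div_of_nonneg_right hl hM0.le
    rw [ind, if_neg hx0, inv_mul_eq_div, abs_of_nonneg (by linarith)]
    linarith

theorem norm_sub_smul_compr_le {M : ℝ} (hε : 0 < ε) (hA : ε • (1 : H →L[ℂ] H) ≤ A) (hM : ‖A‖ ≤ M)
    (hεM : ε ≤ M) (hp : IsStarProjection p) : ‖p - M⁻¹ • compr p A‖ ≤ 1 - ε / M := by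
  rw [sub_smul_compr_eq_cfc hε hA hp]
  exact norm_cfc_le (sub_nonneg.2 ((div_le_one (hε.trans_le hεM)).2 hεM))
    fun x hx => abs_ind_sub_le hε hA hM hεM hp hx

/-- The power series of the logarithm around `M`, on the range of `p`:
`ln M · p - ln (p A p) = ∑ (p - p A p / M)^{k+1} / (k+1)`, convergent in norm. The junk value
`Real.log 0 = 0` is what makes the identity hold on the complement of the range. -/
theorem hasSum_log_compr {M : ℝ} (hε : 0 < ε) (hA : ε • (1 : H →L[ℂ] H) ≤ A) (hM : ‖A‖ ≤ M)
    (hεM : ε ≤ M) (hp : IsStarProjection p) :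
    HasSum (fun k : ℕ => ((k : ℝ) + 1)⁻¹ • (p - M⁻¹ • compr p A) ^ (k + 1))
      (Real.log M • p - CFC.log (compr p A)) := by
  have hM0 : 0 < M := hε.trans_le hεM
  have ha := isSelfAdjoint_compr (isSelfAdjoint_of_smul_one_le hε hA).1 hp
  have cind := continuousOn_spectrum_compr hε hA hp continuousOn_ind_Ioi
  have clog := continuousOn_spectrum_compr hε hA hp (f := Real.log)
    (Real.continuousOn_log.mono fun x hx => (Set.mem_Ioi.1 hx).ne')
  have cX : ContinuousOn (fun x => ind x - M⁻¹ * x) (spectrum ℝ (compr p A)) :=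
    cind.sub (by fun_prop)
  set r := 1 - ε / M with hr
  have hr1 : r < 1 := by have := div_pos hε hM0; linarith
  have hr0 : 0 ≤ r := sub_nonneg.2 ((div_le_one hM0).2 hεM)
  have ck : ∀ k : ℕ, ContinuousOn (fun x => ((k : ℝ) + 1)⁻¹ * (ind x - M⁻¹ * x) ^ (k + 1))
      (spectrum ℝ (compr p A)) := fun k => continuousOn_const.mul (cX.pow _)
  have hu := tendstoUniformlyOn_tsum (u := fun k : ℕ => r ^ (k + 1))
    (f := fun (k : ℕ) (x : ℝ) => ((k : ℝ) + 1)⁻¹ * (ind x - M⁻¹ * x) ^ (k + 1))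
    (s := spectrum ℝ (compr p A))
    ((summable_nat_add_iff 1).2 (summable_geometric_of_lt_one hr0 hr1)) (fun k x hx => by
      rw [norm_mul, norm_pow, Real.norm_eq_abs (ind x - _), Real.norm_of_nonneg (by positivity)]
      have h1 : |ind x - M⁻¹ * x| ^ (k + 1) ≤ r ^ (k + 1) :=
        pow_le_pow_left₀ (abs_nonneg _) (abs_ind_sub_le hε hA hM hεM hp hx) _
      have h2 : ((k : ℝ) + 1)⁻¹ ≤ 1 := inv_le_one_of_one_le₀ (by linarith [k.cast_nonneg (α := ℝ)])
      exact (mul_le_of_le_one_left (by positivity) h2).trans h1)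
  have ht := tendsto_cfc_fun hu (Filter.Eventually.of_forall fun t =>
    continuousOn_finsetSum t fun k _ => ck k)
  have e2 : cfc (fun x => ∑' k : ℕ, ((k : ℝ) + 1)⁻¹ * (ind x - M⁻¹ * x) ^ (k + 1)) (compr p A) =
      Real.log M • p - CFC.log (compr p A) := by
    have e3 : Real.log M • p - CFC.log (compr p A) =
        cfc (fun x => Real.log M * ind x - Real.log x) (compr p A) := by
      rw [cfc_sub (fun x => Real.log M * ind x) Real.log _ (continuousOn_const.mul cind) clog,
        cfc_const_mul _ ind _ cind, cfc_ind_compr hε hA hp, CFC.log]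
    rw [e3]
    refine cfc_congr fun x hx => ?_
    rcases spectrum_compr_subset hε hA hM hp hx with rfl | ⟨hl, hu⟩
    · simp [ind]
    · have hx0 : x ≠ 0 := (hε.trans_le hl).ne'
      have habs := (abs_ind_sub_le hε hA hM hεM hp hx).trans_lt hr1
      have h := (Real.hasSum_pow_div_log_of_abs_lt_one habs).tsum_eq
      have e4 : 1 - (ind x - M⁻¹ * x) = x / M := by rw [ind, if_neg hx0]; ring
      rw [e4, Real.log_div hx0 hM0.ne'] at h
      simp only [← div_eq_inv_mul (((_ : ℝ)) ^ _)]
      rw [h, ind, if_neg hx0]; ring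
  rw [e2] at ht
  refine ht.congr fun t => ?_
  have e5 : (fun x => ∑ k ∈ t, ((k : ℝ) + 1)⁻¹ * (ind x - M⁻¹ * x) ^ (k + 1)) =
      ∑ k ∈ t, fun x => ((k : ℝ) + 1)⁻¹ * (ind x - M⁻¹ * x) ^ (k + 1) := by
    ext x; simp
  rw [e5, cfc_sum _ _ _ fun k _ => ck k]
  refine Finset.sum_congr rfl fun k _ => ?_
  rw [cfc_const_mul _ (fun x => (ind x - M⁻¹ * x) ^ (k + 1)) _ (cX.pow _), cfc_pow _ _ _ cX,
    sub_smul_compr_eq_cfc hε hA hp]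

end Gap

/-- Telescoping of a difference of powers of two elements that need not commute. -/
theorem pow_sub_pow_eq_sum {R : Type*} [Ring R] (X Y : R) (n : ℕ) :
    Y ^ (n + 1) - X ^ (n + 1) = ∑ i ∈ Finset.range (n + 1), Y ^ i * (Y - X) * X ^ (n - i) := by
  have h := Finset.sum_range_sub (fun i => Y ^ i * X ^ (n + 1 - i)) (n + 1)
  simp only [Nat.sub_self, pow_zero, mul_one, one_mul, Nat.sub_zero] at h
  rw [← h]
  refine Finset.sum_congr rfl fun i hi => ?_
  have hi' : i ≤ n := Nat.lt_succ_iff.1 (Finset.mem_range.1 hi)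
  have e1 : n + 1 - (i + 1) = n - i := by omega
  have e2 : n + 1 - i = (n - i) + 1 := by omega
  rw [e1, e2, pow_succ Y, pow_succ' X]
  noncomm_ring

end TraceIneq

/-! ### The trace of the logarithmic series -/

namespace TraceIneq

variable {H : Type*} [NormedAddCommGroup H] [InnerProductSpace ℂ H]

theorem norm_pow_mul_le {X p : H →L[ℂ] H} {r : ℝ} (hX : ‖X‖ ≤ r) (hp : ‖p‖ ≤ 1) (n : ℕ) :
    ‖X ^ n * p‖ ≤ r ^ n := by
  induction n with
  | zero => simpa using hp
  | succ n ih =>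
    rw [pow_succ', pow_succ', mul_assoc]
    exact (norm_mul_le _ _).trans
      (mul_le_mul hX ih (norm_nonneg _) ((norm_nonneg _).trans hX))

theorem norm_mul_pow_le {X p : H →L[ℂ] H} {r : ℝ} (hX : ‖X‖ ≤ r) (hp : ‖p‖ ≤ 1) (n : ℕ) :
    ‖p * X ^ n‖ ≤ r ^ n := by
  induction n with
  | zero => simpa using hp
  | succ n ih =>
    rw [pow_succ, pow_succ, ← mul_assoc]
    exact (norm_mul_le _ _).trans
      (mul_le_mul ih hX (norm_nonneg _) ((norm_nonneg _).trans ih))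

section Functional

variable {ι : Type*} (b : HilbertBasis ι ℂ H)

/-- The functional `K ↦ Tr (T K)` for `T = S Q` with `S`, `Q` Hilbert–Schmidt and `Q` self-adjoint, in
the form `∑ ⟨Q b i, K S b i⟩`, whose terms are at most `‖K‖ (‖S b i‖² + ‖Q b i‖²)`. -/
noncomputable def factorTrace (S Q K : H →L[ℂ] H) : ℂ := ∑' i, ⟪Q (b i), K (S (b i))⟫_ℂ

variable {b}

theorem norm_inner_factor_le (S Q K : H →L[ℂ] H) (i : ι) :
    ‖⟪Q (b i), K (S (b i))⟫_ℂ‖ ≤ ‖K‖ * (‖S (b i)‖ ^ 2 + ‖Q (b i)‖ ^ 2) := by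
  calc ‖⟪Q (b i), K (S (b i))⟫_ℂ‖ ≤ ‖Q (b i)‖ * (‖K‖ * ‖S (b i)‖) :=
        (norm_inner_le_norm _ _).trans (by gcongr; exact K.le_opNorm _)
    _ = ‖K‖ * (‖S (b i)‖ * ‖Q (b i)‖) := by ring
    _ ≤ _ := by
        gcongr
        nlinarith [sq_nonneg (‖S (b i)‖ - ‖Q (b i)‖), sq_nonneg ‖S (b i)‖, sq_nonneg ‖Q (b i)‖]

theorem norm_factorTrace_le {S Q : H →L[ℂ] H} (hS : IsHilbertSchmidt b S)
    (hQ : IsHilbertSchmidt b Q) (K : H →L[ℂ] H) :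
    ‖factorTrace b S Q K‖ ≤ ‖K‖ * ∑' i, (‖S (b i)‖ ^ 2 + ‖Q (b i)‖ ^ 2) := by
  have hs := (Summable.add hS hQ).mul_left ‖K‖
  rw [← tsum_mul_left]
  exact tsum_of_norm_bounded hs.hasSum fun i => norm_inner_factor_le S Q K i

/-- Normality: the functional is continuous along a bounded family that converges pointwise, here in
the strong form of eventual equality at each vector. -/
theorem tendsto_factorTrace {S Q : H →L[ℂ] H} (hS : IsHilbertSchmidt b S)
    (hQ : IsHilbertSchmidt b Q) {α : Type*} {l : Filter α} {K : α → H →L[ℂ] H} {K₀ : H →L[ℂ] H}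
    {c : ℝ} (hc : ∀ a, ‖K a‖ ≤ c) (h : ∀ x, ∀ᶠ a in l, K a x = K₀ x) :
    Filter.Tendsto (fun a => factorTrace b S Q (K a)) l (nhds (factorTrace b S Q K₀)) := by
  refine tendsto_tsum_of_dominated_convergence ((Summable.add hS hQ).mul_left c) (fun i => ?_)
    (Filter.Eventually.of_forall fun a i => (norm_inner_factor_le S Q (K a) i).trans ?_)
  · refine tendsto_const_nhds.congr' ?_
    filter_upwards [h (S (b i))] with a ha
    rw [ha]
  · gcongr
    exact hc a

variable [CompleteSpace H]

theorem tsum_inner_mul_factor {S Q : H →L[ℂ] H} (hS : IsHilbertSchmidt b S)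
    (hQ : IsHilbertSchmidt b Q) (hQa : IsSelfAdjoint Q) (L R : H →L[ℂ] H) :
    ∑' i, ⟪b i, (L * (S * Q) * R) (b i)⟫_ℂ = factorTrace b S Q (R * L) := by
  have h := (hS.mul_left L).1.tsum_inner_mul_comm (hQ.mul_right R).1
  have e : L * (S * Q) * R = L * S * (Q * R) := by simp only [mul_assoc]
  rw [e, h]
  refine tsum_congr fun i => ?_
  have : Q * R * (L * S) = Q * (R * L * S) := by simp only [mul_assoc]
  rw [this, mul_apply_eq_comp Q]
  have h2 := ContinuousLinearMap.adjoint_inner_left Q ((R * L * S) (b i)) (b i)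
  rw [← ContinuousLinearMap.star_eq_adjoint, hQa.star_eq] at h2
  exact h2.symm

end Functional

variable [CompleteSpace H]

/-- The `k`-th term of the series for `A_p (ln A_p - ln B_p)` that results from expanding both
logarithms around `M`; the difference `A - B` is a factor of each summand. -/
noncomputable def logSeriesTerm (M : ℝ) (p A B : H →L[ℂ] H) (k : ℕ) : H →L[ℂ] H :=
  (((k : ℝ) + 1) * M)⁻¹ • ∑ i ∈ Finset.range (k + 1),
    (compr p A * (p - M⁻¹ • compr p B) ^ i * p) * (A - B) * (p * (p - M⁻¹ • compr p A) ^ (k - i))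

/-- The product, in reversed order, of the factors to the right and to the left of `A - B` in the
`i`-th summand of `logSeriesTerm`. -/
noncomputable def logKernel (M : ℝ) (p A B : H →L[ℂ] H) (k i : ℕ) : H →L[ℂ] H :=
  (p * (p - M⁻¹ • compr p A) ^ (k - i)) * (compr p A * (p - M⁻¹ • compr p B) ^ i * p)

section Series

variable {A B p : H →L[ℂ] H} {ε M : ℝ}

theorem hasSum_entropyOp (hε : 0 < ε) (hA : ε • (1 : H →L[ℂ] H) ≤ A)
    (hB : ε • (1 : H →L[ℂ] H) ≤ B) (hMA : ‖A‖ ≤ M) (hMB : ‖B‖ ≤ M) (hεM : ε ≤ M)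
    (hp : IsStarProjection p) :
    HasSum (logSeriesTerm M p A B) (entropyOp (compr p A) (compr p B)) := by
  have hM0 : 0 < M := hε.trans_le hεM
  have h := ((hasSum_log_compr hε hB hMB hεM hp).sub (hasSum_log_compr hε hA hMA hεM hp)).mul_left
    (compr p A)
  have e : compr p A * (Real.log M • p - CFC.log (compr p B) -
      (Real.log M • p - CFC.log (compr p A))) = entropyOp (compr p A) (compr p B) := by
    rw [entropyOp, sub_sub_sub_cancel_left]
  rw [e] at h
  refine h.congr_fun fun k => ?_
  rw [← smul_sub, pow_sub_pow_eq_sum, logSeriesTerm, mul_smul_comm, mul_inv, mul_smul,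
    Finset.mul_sum, Finset.smul_sum (r := M⁻¹)]
  congr 1
  refine Finset.sum_congr rfl fun i _ => ?_
  have e2 : p - M⁻¹ • compr p B - (p - M⁻¹ • compr p A) = M⁻¹ • (p * (A - B) * p) := by
    rw [sub_sub_sub_cancel_left, ← smul_sub, compr, compr, ← sub_mul, ← mul_sub]
  rw [e2]
  simp only [mul_smul_comm, smul_mul_assoc, mul_assoc]

theorem norm_leftFactor_le (hε : 0 < ε) (hB : ε • (1 : H →L[ℂ] H) ≤ B) (hMA : ‖A‖ ≤ M)
    (hMB : ‖B‖ ≤ M) (hεM : ε ≤ M) (hp : IsStarProjection p) (i : ℕ) :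
    ‖compr p A * (p - M⁻¹ • compr p B) ^ i * p‖ ≤ M * (1 - ε / M) ^ i := by
  have h1 := norm_le_one_of_isStarProjection hp
  have h2 := norm_sub_smul_compr_le hε hB hMB hεM hp
  have h3 : ‖(p - M⁻¹ • compr p B) ^ i * p‖ ≤ (1 - ε / M) ^ i := by
    exact norm_pow_mul_le h2 h1 i
  rw [mul_assoc]
  refine (norm_mul_le _ _).trans ?_
  have := (norm_compr_le hp A).trans hMA
  have hM0 : 0 < M := hε.trans_le hεM
  gcongr

theorem norm_rightFactor_le (hε : 0 < ε) (hA : ε • (1 : H →L[ℂ] H) ≤ A) (hMA : ‖A‖ ≤ M)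
    (hεM : ε ≤ M) (hp : IsStarProjection p) (i : ℕ) :
    ‖p * (p - M⁻¹ • compr p A) ^ i‖ ≤ (1 - ε / M) ^ i :=
  norm_mul_pow_le (norm_sub_smul_compr_le hε hA hMA hεM hp) (norm_le_one_of_isStarProjection hp) i

theorem norm_logKernel_le (hε : 0 < ε) (hA : ε • (1 : H →L[ℂ] H) ≤ A)
    (hB : ε • (1 : H →L[ℂ] H) ≤ B) (hMA : ‖A‖ ≤ M) (hMB : ‖B‖ ≤ M) (hεM : ε ≤ M)
    (hp : IsStarProjection p) {k i : ℕ} (hi : i ∈ Finset.range (k + 1)) :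
    ‖logKernel M p A B k i‖ ≤ M * (1 - ε / M) ^ k := by
  have hM0 : 0 < M := hε.trans_le hεM
  have hr0 : 0 ≤ 1 - ε / M := sub_nonneg.2 ((div_le_one hM0).2 hεM)
  have e : k = (k - i) + i := by have := Finset.mem_range.1 hi; omega
  calc ‖logKernel M p A B k i‖ ≤ (1 - ε / M) ^ (k - i) * (M * (1 - ε / M) ^ i) :=
        (norm_mul_le _ _).trans (mul_le_mul (norm_rightFactor_le hε hA hMA hεM hp _)
          (norm_leftFactor_le hε hB hMA hMB hεM hp i) (norm_nonneg _) (by positivity))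
    _ = M * (1 - ε / M) ^ k := by
        conv_rhs => rw [e, pow_add]
        ring

variable {ι : Type*} {b : HilbertBasis ι ℂ H} {S Q : H →L[ℂ] H}

theorem traceBound_logSeriesTerm (hε : 0 < ε) (hA : ε • (1 : H →L[ℂ] H) ≤ A)
    (hB : ε • (1 : H →L[ℂ] H) ≤ B) (hMA : ‖A‖ ≤ M) (hMB : ‖B‖ ≤ M) (hεM : ε ≤ M)
    (hp : IsStarProjection p) (hT : A - B = S * Q) (hSa : IsSelfAdjoint S)
    (hS : IsHilbertSchmidt b S) (hQ : IsHilbertSchmidt b Q) {c : ℝ}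
    (hSc : ∑' i, ‖S (b i)‖ ^ 2 ≤ c) (hQc : ∑' i, ‖Q (b i)‖ ^ 2 ≤ c) (k : ℕ) :
    TraceBound b (logSeriesTerm M p A B k) (c * (1 - ε / M) ^ k) := by
  have hM0 : 0 < M := hε.trans_le hεM
  have hr0 : 0 ≤ 1 - ε / M := sub_nonneg.2 ((div_le_one hM0).2 hεM)
  have hc : 0 ≤ c := (tsum_nonneg fun i => by positivity).trans hSc
  have h1 : TraceBound b (∑ i ∈ Finset.range (k + 1),
      (compr p A * (p - M⁻¹ • compr p B) ^ i * p) * (A - B) *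
        (p * (p - M⁻¹ • compr p A) ^ (k - i)))
      (∑ i ∈ Finset.range (k + 1), M * (1 - ε / M) ^ k * c) := by
    refine TraceBound.sum fun i hi => ?_
    have h := traceBound_mul_mul hS hQ (compr p A * (p - M⁻¹ • compr p B) ^ i * p)
      (p * (p - M⁻¹ • compr p A) ^ (k - i)) hSc hQc
    rw [hSa.star_eq, ← hT] at h
    refine h.mono ?_
    have e : k = i + (k - i) := by have := Finset.mem_range.1 hi; omega
    have h2 : M * (1 - ε / M) ^ k = (M * (1 - ε / M) ^ i) * (1 - ε / M) ^ (k - i) := by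
      conv_lhs => rw [e, pow_add]
      ring
    rw [h2]
    gcongr
    · exact norm_leftFactor_le hε hB hMA hMB hεM hp i
    · exact norm_rightFactor_le hε hA hMA hεM hp _
  have h2 := h1.smul (((((k : ℝ) + 1) * M)⁻¹ : ℝ) : ℂ)
  rw [Complex.coe_smul] at h2
  refine h2.mono (le_of_eq ?_)
  rw [Finset.sum_const, Finset.card_range, nsmul_eq_mul, Complex.norm_real,
    Real.norm_of_nonneg (by positivity)]
  push_cast
  field_simp

/-- The trace of `logSeriesTerm`, expressed through `factorTrace`. -/
noncomputable def logTrace (b : HilbertBasis ι ℂ H) (S Q : H →L[ℂ] H) (M : ℝ)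
    (p A B : H →L[ℂ] H) (k : ℕ) : ℂ :=
  ((((k : ℝ) + 1) * M)⁻¹ : ℝ) *
    ∑ i ∈ Finset.range (k + 1), factorTrace b S Q (logKernel M p A B k i)

theorem tsum_inner_logSeriesTerm (hT : A - B = S * Q)
    (hSa : IsSelfAdjoint S) (hQa : IsSelfAdjoint Q)
    (hS : IsHilbertSchmidt b S) (hQ : IsHilbertSchmidt b Q) (k : ℕ) :
    ∑' j, ⟪b j, logSeriesTerm M p A B k (b j)⟫_ℂ = logTrace b S Q M p A B k := by
  simp only [logSeriesTerm, logTrace, logKernel, hT]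
  rw [← Complex.coe_smul]
  simp only [smul_apply, sum_apply, inner_smul_right, inner_sum]
  rw [tsum_mul_left, Summable.tsum_finsetSum]
  · congr 1
    refine Finset.sum_congr rfl fun i _ => ?_
    exact tsum_inner_mul_factor hS hQ hQa _ _
  · intro i _
    have h := traceBound_mul_mul hS hQ (compr p A * (p - M⁻¹ • compr p B) ^ i * p)
      (p * (p - M⁻¹ • compr p A) ^ (k - i)) (le_max_left _ _) (le_max_right _ _)
    rw [hSa.star_eq] at h
    exact h.summable.of_norm

/-- `A_p (ln A_p - ln B_p)` has a trace bound, and its trace along `b` is the sum of the series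
`logTrace`. Taking `p = 1` covers `A (ln A - ln B)` itself. -/
theorem entropyOp_traceBound_and_trace (hε : 0 < ε) (hA : ε • (1 : H →L[ℂ] H) ≤ A)
    (hB : ε • (1 : H →L[ℂ] H) ≤ B) (hMA : ‖A‖ ≤ M) (hMB : ‖B‖ ≤ M) (hεM : ε ≤ M)
    (hp : IsStarProjection p) (hT : A - B = S * Q) (hSa : IsSelfAdjoint S) (hQa : IsSelfAdjoint Q)
    (hS : IsHilbertSchmidt b S) (hQ : IsHilbertSchmidt b Q) :
    (∃ C, TraceBound b (entropyOp (compr p A) (compr p B)) C) ∧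
      ∑' j, ⟪b j, entropyOp (compr p A) (compr p B) (b j)⟫_ℂ = ∑' k, logTrace b S Q M p A B k := by
  have hM0 : 0 < M := hε.trans_le hεM
  have hr0 : 0 ≤ 1 - ε / M := sub_nonneg.2 ((div_le_one hM0).2 hεM)
  have hr1 : 1 - ε / M < 1 := by have := div_pos hε hM0; linarith
  have h := TraceBound.hasSum (hasSum_entropyOp hε hA hB hMA hMB hεM hp)
    (traceBound_logSeriesTerm hε hA hB hMA hMB hεM hp hT hSa hS hQ (le_max_left _ _)
      (le_max_right _ _)) ((summable_geometric_of_lt_one hr0 hr1).mul_left _)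
  refine ⟨⟨_, h.1⟩, h.2.trans (tsum_congr fun k => ?_)⟩
  exact tsum_inner_logSeriesTerm hT hSa hQa hS hQ k

/-- The traces for projections that converge pointwise to `1` converge to the trace for `1`: the
series is dominated by a geometric series, uniformly in the projection. -/
theorem tendsto_tsum_logTrace (hε : 0 < ε) (hA : ε • (1 : H →L[ℂ] H) ≤ A)
    (hB : ε • (1 : H →L[ℂ] H) ≤ B) (hMA : ‖A‖ ≤ M) (hMB : ‖B‖ ≤ M) (hεM : ε ≤ M)
    (hS : IsHilbertSchmidt b S) (hQ : IsHilbertSchmidt b Q)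
    {α : Type*} {l : Filter α} {q : α → H →L[ℂ] H} (hq : ∀ a, IsStarProjection (q a))
    (hl : ∀ x, ∀ᶠ a in l, q a x = x) :
    Filter.Tendsto (fun a => ∑' k, logTrace b S Q M (q a) A B k) l
      (nhds (∑' k, logTrace b S Q M 1 A B k)) := by
  have hM0 : 0 < M := hε.trans_le hεM
  have hr0 : 0 ≤ 1 - ε / M := sub_nonneg.2 ((div_le_one hM0).2 hεM)
  have hr1 : 1 - ε / M < 1 := by have := div_pos hε hM0; linarith
  set c := ∑' i, (‖S (b i)‖ ^ 2 + ‖Q (b i)‖ ^ 2) with hc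
  have hc0 : 0 ≤ c := tsum_nonneg fun i => by positivity
  -- pointwise eventual equality is stable under the operations that build the kernels
  have hcompr : ∀ (K : H →L[ℂ] H) (x : H), ∀ᶠ a in l, compr (q a) K x = compr 1 K x := by
    intro K x
    filter_upwards [hl x, hl (K x)] with a h1 h2
    simp [compr, mul_apply_eq_comp, h1, h2]
  have hmul : ∀ {K L : α → H →L[ℂ] H} {K₀ L₀ : H →L[ℂ] H}, (∀ x, ∀ᶠ a in l, K a x = K₀ x) →
      (∀ x, ∀ᶠ a in l, L a x = L₀ x) → ∀ x, ∀ᶠ a in l, (K a * L a) x = (K₀ * L₀) x := by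
    intro K L K₀ L₀ hK hL x
    filter_upwards [hL x, hK (L₀ x)] with a h1 h2
    rw [mul_apply_eq_comp, mul_apply_eq_comp, h1, h2]
  have hpow : ∀ {K : α → H →L[ℂ] H} {K₀ : H →L[ℂ] H}, (∀ x, ∀ᶠ a in l, K a x = K₀ x) →
      ∀ n : ℕ, ∀ x, ∀ᶠ a in l, (K a ^ n) x = (K₀ ^ n) x := by
    intro K K₀ hK n
    induction n with
    | zero => intro x; simp
    | succ n ih => simp only [pow_succ]; exact hmul ih hK
  have hsub : ∀ (K : H →L[ℂ] H) (x : H), ∀ᶠ a in l,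
      (q a - M⁻¹ • compr (q a) K) x = (1 - M⁻¹ • compr 1 K) x := by
    intro K x
    filter_upwards [hl x, hcompr K x] with a h1 h2
    rw [sub_apply, sub_apply, smul_apply, smul_apply, h1, h2, one_apply_eq_self]
  have hl' : ∀ x, ∀ᶠ a in l, q a x = (1 : H →L[ℂ] H) x := hl
  have hker : ∀ k i, ∀ x, ∀ᶠ a in l, logKernel M (q a) A B k i x = logKernel M 1 A B k i x :=
    fun k i => hmul (hmul hl' (hpow (hsub A) _)) (hmul (hmul (hcompr A) (hpow (hsub B) _)) hl')
  refine tendsto_tsum_of_dominated_convergence (bound := fun k => c * (1 - ε / M) ^ k)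
    ((summable_geometric_of_lt_one hr0 hr1).mul_left _) (fun k => ?_)
    (Filter.Eventually.of_forall fun a k => ?_)
  · refine Filter.Tendsto.const_mul _ (tendsto_finsetSum _ fun i hi => ?_)
    exact tendsto_factorTrace hS hQ
      (fun a => norm_logKernel_le hε hA hB hMA hMB hεM (hq a) hi) (hker k i)
  · rw [logTrace, norm_mul, Complex.norm_real, Real.norm_of_nonneg (by positivity)]
    calc (((k : ℝ) + 1) * M)⁻¹ * ‖∑ i ∈ Finset.range (k + 1),
          factorTrace b S Q (logKernel M (q a) A B k i)‖
        ≤ (((k : ℝ) + 1) * M)⁻¹ * ∑ i ∈ Finset.range (k + 1), M * (1 - ε / M) ^ k * c := by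
          gcongr
          refine (norm_sum_le _ _).trans (Finset.sum_le_sum fun i hi => ?_)
          refine (norm_factorTrace_le hS hQ _).trans ?_
          gcongr
          exact norm_logKernel_le hε hA hB hMA hMB hεM (hq a) hi
      _ = c * (1 - ε / M) ^ k := by
          rw [Finset.sum_const, Finset.card_range, nsmul_eq_mul]
          push_cast
          field_simp

end Series

end TraceIneq

/-! ### Compressions of finite rank -/

namespace TraceIneq

open scoped ComplexOrder Matrix

variable {H : Type*} [NormedAddCommGroup H] [InnerProductSpace ℂ H]

/-- `e` is a finite orthonormal family and `p` is the orthogonal projection onto its span. -/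
structure IsFrame {ι : Type*} [Fintype ι] (e : ι → H) (p : H →L[ℂ] H) : Prop where
  orthonormal : Orthonormal ℂ e
  apply_eq : ∀ x, p x = ∑ i, ⟪e i, x⟫_ℂ • e i

/-- The matrix `⟨e i, X e j⟩` of the compression of `X` to the span of `e`. -/
noncomputable def opMatrix {ι : Type*} (e : ι → H) (X : H →L[ℂ] H) : Matrix ι ι ℂ :=
  Matrix.of fun i j => ⟪e i, X (e j)⟫_ℂ

variable {ι : Type*} {e : ι → H} {p : H →L[ℂ] H}

theorem opMatrix_add (X Y : H →L[ℂ] H) : opMatrix e (X + Y) = opMatrix e X + opMatrix e Y := by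
  ext i j; simp [opMatrix]

theorem opMatrix_sub (X Y : H →L[ℂ] H) : opMatrix e (X - Y) = opMatrix e X - opMatrix e Y := by
  ext i j; simp [opMatrix]

theorem opMatrix_one [DecidableEq ι] (he : Orthonormal ℂ e) : opMatrix e 1 = 1 := by
  ext i j
  simp [opMatrix, orthonormal_iff_ite.1 he, Matrix.one_apply]

theorem opMatrix_conjTranspose [CompleteSpace H] (X : H →L[ℂ] H) : (opMatrix e X)ᴴ = opMatrix e (star X) := by
  ext i j
  simp only [opMatrix, Matrix.conjTranspose_apply, Matrix.of_apply]
  rw [ContinuousLinearMap.star_eq_adjoint, ContinuousLinearMap.adjoint_inner_right]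
  exact inner_conj_symm _ _

variable [Fintype ι]

theorem IsFrame.apply_self (h : IsFrame e p) (i : ι) : p (e i) = e i := by
  classical
  rw [h.apply_eq]
  simp [orthonormal_iff_ite.1 h.orthonormal]

theorem IsFrame.tsum_inner (h : IsFrame e p) {κ : Type*} (b : HilbertBasis κ ℂ H)
    {X : H →L[ℂ] H} (hX : X * p = X) :
    ∑' j, ⟪b j, X (b j)⟫_ℂ = (opMatrix e X).trace := by
  have h1 : ∀ j, ⟪b j, X (b j)⟫_ℂ = ∑ i, ⟪e i, b j⟫_ℂ * ⟪b j, X (e i)⟫_ℂ := by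
    intro j
    have : X (b j) = ∑ i, ⟪e i, b j⟫_ℂ • X (e i) := by
      conv_lhs => rw [← hX, mul_apply_eq_comp, h.apply_eq, map_sum]
      simp
    rw [this, inner_sum]
    simp [inner_smul_right]
  simp only [h1]
  rw [Summable.tsum_finsetSum fun i _ => b.summable_inner_mul_inner _ _]
  simp only [b.tsum_inner_mul_inner]
  rfl

variable [CompleteSpace H]

theorem IsFrame.inner_left (h : IsFrame e p) (hp : IsStarProjection p) (i : ι) (x : H) :
    ⟪e i, p x⟫_ℂ = ⟪e i, x⟫_ℂ := by
  conv_rhs => rw [← h.apply_self i, ← ContinuousLinearMap.adjoint_inner_right,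
    ← ContinuousLinearMap.star_eq_adjoint, hp.isSelfAdjoint.star_eq]

theorem IsFrame.opMatrix_mul (h : IsFrame e p) (hp : IsStarProjection p) {X : H →L[ℂ] H}
    (hX : Commute X p) (Y : H →L[ℂ] H) : opMatrix e (X * Y) = opMatrix e X * opMatrix e Y := by
  ext i j
  have h1 : ⟪e i, X (Y (e j))⟫_ℂ = ⟪e i, X (p (Y (e j)))⟫_ℂ := by
    rw [← h.inner_left hp, ← mul_apply_eq_comp p X, ← hX.eq, mul_apply_eq_comp]
  simp only [opMatrix, Matrix.of_apply, Matrix.mul_apply, mul_apply_eq_comp]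
  rw [h1, h.apply_eq, map_sum, inner_sum]
  refine Finset.sum_congr rfl fun k _ => ?_
  rw [map_smul, inner_smul_right, mul_comm]

theorem IsFrame.opMatrix_compr (h : IsFrame e p) (hp : IsStarProjection p) (X : H →L[ℂ] H) :
    opMatrix e (compr p X) = opMatrix e X := by
  ext i j
  simp only [opMatrix, Matrix.of_apply, compr, mul_apply_eq_comp]
  rw [h.inner_left hp, h.apply_self]

theorem posSemidef_opMatrix {X : H →L[ℂ] H} (hX : 0 ≤ X) : (opMatrix e X).PosSemidef := by
  obtain ⟨R, rfl⟩ := CStarAlgebra.nonneg_iff_eq_star_mul_self.1 hX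
  have : opMatrix e (star R * R) = Matrix.gram ℂ (fun i => R (e i)) := by
    ext i j
    simp [opMatrix, Matrix.gram_apply, ContinuousLinearMap.star_eq_adjoint,
      ContinuousLinearMap.adjoint_inner_right]
  rw [this]
  exact Matrix.posSemidef_gram ℂ _

theorem posDef_opMatrix (he : Orthonormal ℂ e) {A : H →L[ℂ] H} {ε : ℝ} (hε : 0 < ε)
    (hA : ε • (1 : H →L[ℂ] H) ≤ A) : (opMatrix e A).PosDef := by
  classical
  have h1 : opMatrix e A = (ε : ℂ) • (1 : Matrix ι ι ℂ) + opMatrix e (A - ε • 1) := by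
    rw [opMatrix_sub, ← opMatrix_one he]
    ext i j
    simp [opMatrix, ← Complex.coe_smul]
  rw [h1]
  refine Matrix.PosDef.add_posSemidef ?_ (posSemidef_opMatrix (sub_nonneg.2 hA))
  exact Matrix.PosDef.one.smul (by exact_mod_cast hε)

/-- An eigenvector of `p A p` in the range of `p` is an eigenvector of `ln (p A p)`, seen on the power
series of the logarithm. -/
theorem log_compr_apply_eigenvector {A : H →L[ℂ] H} {ε : ℝ} (hε : 0 < ε)
    (hA : ε • (1 : H →L[ℂ] H) ≤ A) (hp : IsStarProjection p) {v : H} {x : ℝ} (hx : 0 < x)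
    (hpv : p v = v) (hv : compr p A v = x • v) :
    CFC.log (compr p A) v = Real.log x • v := by
  set M := ‖A‖ + ε + x with hM
  have hMA : ‖A‖ ≤ M := by linarith
  have hεM : ε ≤ M := by linarith [norm_nonneg A]
  have hxM : x ≤ M := by linarith [norm_nonneg A]
  have hM0 : 0 < M := by linarith
  have hX : (p - M⁻¹ • compr p A) v = (1 - M⁻¹ * x) • v := by
    rw [sub_apply, smul_apply, hpv, hv, smul_smul, sub_smul, one_smul]
  have h2 : ∀ n : ℕ, ((p - M⁻¹ • compr p A) ^ n) v = (1 - M⁻¹ * x) ^ n • v := by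
    intro n
    induction n with
    | zero => simp
    | succ n ih =>
      rw [pow_succ', mul_apply_eq_comp, ih, ContinuousLinearMap.map_smul_of_tower, hX, smul_smul,
        pow_succ]
  have h1 : HasSum (fun k : ℕ => (((k : ℝ) + 1)⁻¹ * (1 - M⁻¹ * x) ^ (k + 1)) • v)
      (Real.log M • v - CFC.log (compr p A) v) := by
    have h := (hasSum_log_compr hε hA hMA hεM hp).mapL (ContinuousLinearMap.apply ℂ H v)
    simp only [ContinuousLinearMap.apply_apply, smul_apply, sub_apply, hpv, h2, smul_smul] at h
    exact h
  have habs : |1 - M⁻¹ * x| < 1 := by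
    have h3 : 0 < M⁻¹ * x := by positivity
    have h4 : M⁻¹ * x ≤ 1 := by rw [inv_mul_eq_div]; exact (div_le_one hM0).2 hxM
    rw [abs_of_nonneg (by linarith)]
    linarith
  have h3 : HasSum (fun k : ℕ => (((k : ℝ) + 1)⁻¹ * (1 - M⁻¹ * x) ^ (k + 1)) • v)
      ((Real.log M - Real.log x) • v) := by
    have h := Real.hasSum_pow_div_log_of_abs_lt_one habs
    have e1 : Real.log (M⁻¹ * x) = Real.log x - Real.log M := by
      rw [inv_mul_eq_div, Real.log_div hx.ne' hM0.ne']
    rw [sub_sub_cancel, e1, neg_sub] at h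
    simp only [div_eq_inv_mul (_ ^ _ : ℝ)] at h
    exact h.smul_const v
  have h4 := h1.unique h3
  rw [sub_smul] at h4
  exact sub_right_injective h4

theorem IsFrame.opMatrix_log_mulVec (h : IsFrame e p) (hp : IsStarProjection p) {A : H →L[ℂ] H}
    {ε : ℝ} (hε : 0 < ε) (hA : ε • (1 : H →L[ℂ] H) ≤ A) {v : ι → ℂ} {x : ℝ} (hx : 0 < x)
    (hv : opMatrix e A *ᵥ v = x • v) :
    opMatrix e (CFC.log (compr p A)) *ᵥ v = Real.log x • v := by
  classical
  set w : H := ∑ j, v j • e j with hw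
  have hmul : ∀ (X : H →L[ℂ] H) i, (opMatrix e X *ᵥ v) i = ⟪e i, X w⟫_ℂ := by
    intro X i
    rw [hw, map_sum, inner_sum]
    simp only [Matrix.mulVec, dotProduct, opMatrix, Matrix.of_apply, map_smul, inner_smul_right]
    exact Finset.sum_congr rfl fun _ _ => mul_comm _ _
  have hin : ∀ i, ⟪e i, w⟫_ℂ = v i := by
    intro i
    rw [← ContinuousLinearMap.id_apply (R₁ := ℂ) w]
    change ⟪e i, (1 : H →L[ℂ] H) w⟫_ℂ = v i
    rw [← hmul, opMatrix_one h.orthonormal, Matrix.one_mulVec]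
  have hpw : p w = w := by
    rw [h.apply_eq]; simp only [hin]; rfl
  have haw : compr p A w = x • w := by
    rw [compr, mul_apply_eq_comp, mul_apply_eq_comp, hpw, h.apply_eq]
    simp only [← hmul, hv, Pi.smul_apply, smul_assoc]
    rw [hw, Finset.smul_sum]
  ext i
  rw [hmul, log_compr_apply_eigenvector hε hA hp hx hpw haw, ← Complex.coe_smul,
    inner_smul_right, hin]
  simp

/-- The trace of `M N` when `N` acts on the eigenvectors of `M` as `f(M)` does. -/
theorem trace_mul_eq_sum_of_mulVec [DecidableEq ι] {M N : Matrix ι ι ℂ} (hM : M.IsHermitian)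
    {f : ℝ → ℝ} (hN : ∀ j, N *ᵥ (hM.eigenvectorBasis j) =
      f (hM.eigenvalues j) • ⇑(hM.eigenvectorBasis j)) :
    (M * N).trace = ((∑ j, hM.eigenvalues j * f (hM.eigenvalues j) : ℝ) : ℂ) := by
  have h := LinearMap.trace_eq_sum_inner (Matrix.toEuclideanLin (M * N)) hM.eigenvectorBasis
  have e1 : LinearMap.trace ℂ _ (Matrix.toEuclideanLin (M * N)) = (M * N).trace := by
    rw [LinearMap.trace_eq_sum_inner _ (EuclideanSpace.basisFun ι ℂ)]
    simp [Matrix.trace, EuclideanSpace.inner_single_left]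
    rfl
  rw [← e1, h]
  push_cast
  refine Finset.sum_congr rfl fun j _ => ?_
  have e2 : Matrix.toEuclideanLin (M * N) (hM.eigenvectorBasis j) =
      (hM.eigenvalues j * f (hM.eigenvalues j)) • hM.eigenvectorBasis j := by
    ext i
    simp only [Matrix.toLpLin_apply, ← Matrix.mulVec_mulVec, hN, Matrix.mulVec_smul,
      hM.mulVec_eigenvectorBasis]
    simp
    ring
  rw [e2, ← Complex.coe_smul, inner_smul_right, inner_self_eq_norm_sq_to_K,
    hM.eigenvectorBasis.orthonormal.1]
  simp

/-- For `p` of finite rank, the trace of `A_p (ln A_p - ln B_p)` is the difference of the sums of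
`x log x` over the eigenvalues of `A_p` and of `B_p` on the range of `p`. In the term `A_p ln B_p`,
the operator `A_p` may be replaced by its pinching `B_p`, since `ln B_p` commutes with `P`. -/
theorem IsFrame.tsum_inner_entropyOp [DecidableEq ι] (h : IsFrame e p) (hp : IsStarProjection p)
    {A B P : H →L[ℂ] H} {ε : ℝ} (hε : 0 < ε) (hA : ε • (1 : H →L[ℂ] H) ≤ A)
    (hB : ε • (1 : H →L[ℂ] H) ≤ B) (hP : IsStarProjection P) (hpP : Commute p P)
    (hBA : B = P * A * P + (1 - P) * A * (1 - P)) {κ : Type*} (b : HilbertBasis κ ℂ H)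
    {Ma Mp : Matrix ι ι ℂ} (ha : opMatrix e A = Ma) (hMp : opMatrix e P = Mp)
    (hMa : Ma.IsHermitian) (hMb : (Matrix.pinch Mp Ma).IsHermitian) :
    ∑' j, ⟪b j, entropyOp (compr p A) (compr p B) (b j)⟫_ℂ =
      ((∑ k, hMa.eigenvalues k * Real.log (hMa.eigenvalues k) -
        ∑ k, hMb.eigenvalues k * Real.log (hMb.eigenvalues k) : ℝ) : ℂ) := by
  have hMpp : Mp * Mp = Mp := by
    rw [← hMp, ← h.opMatrix_mul hp hpP.symm, hP.isIdempotentElem.eq]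
  have hb : opMatrix e B = Matrix.pinch Mp Ma := by
    have hpP' : Commute (1 - P) p := (Commute.one_left p).sub_left hpP.symm
    have e1 : opMatrix e (1 - P) = 1 - Mp := by
      rw [opMatrix_sub, opMatrix_one h.orthonormal, hMp]
    have e2 : ∀ Q : H →L[ℂ] H, Commute Q p → opMatrix e (Q * A * Q) =
        opMatrix e Q * Ma * opMatrix e Q := by
      intro Q hQ
      have h3 : opMatrix e (A * Q) = opMatrix e A * opMatrix e Q := by
        have h4 : ∀ X : H →L[ℂ] H, opMatrix e X = opMatrix e (compr p X) :=
          fun X => (h.opMatrix_compr hp X).symm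
        rw [h4 (A * Q), h4 A, ← h.opMatrix_mul hp]
        · congr 1
          simp only [compr, mul_assoc]
          rw [hQ.eq]
        · rw [Commute, SemiconjBy, mul_compr hp, compr_mul hp]
      rw [mul_assoc, h.opMatrix_mul hp hQ, h3, ha, mul_assoc]
    rw [hBA, opMatrix_add, e2 P hpP.symm, e2 (1 - P) hpP', e1, hMp, Matrix.pinch]
  have pA : Ma.PosDef := ha ▸ posDef_opMatrix h.orthonormal hε hA
  have pB : (Matrix.pinch Mp Ma).PosDef := hb ▸ posDef_opMatrix h.orthonormal hε hB
  have cA : Commute (compr p A) p := by rw [Commute, SemiconjBy, mul_compr hp, compr_mul hp]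
  have cB : Commute (compr p B) p := by rw [Commute, SemiconjBy, mul_compr hp, compr_mul hp]
  set LA := CFC.log (compr p A) with hLA
  set LB := CFC.log (compr p B) with hLB
  have cLA : Commute LA p := cA.cfc_real _
  have cLB : Commute LB p := cB.cfc_real _
  have hX : entropyOp (compr p A) (compr p B) * p = entropyOp (compr p A) (compr p B) := by
    rw [entropyOp, mul_assoc, (cLA.sub_left cLB).eq, ← mul_assoc, compr_mul hp]
  rw [h.tsum_inner b hX, entropyOp, h.opMatrix_mul hp cA, h.opMatrix_compr hp, opMatrix_sub, ha,
    Matrix.mul_sub, Matrix.trace_sub]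
  have t1 : (Ma * opMatrix e LA).trace =
      ((∑ k, hMa.eigenvalues k * Real.log (hMa.eigenvalues k) : ℝ) : ℂ) := by
    refine trace_mul_eq_sum_of_mulVec hMa fun j => ?_
    refine h.opMatrix_log_mulVec hp hε hA (pA.eigenvalues_pos j) ?_
    rw [ha]
    exact hMa.mulVec_eigenvectorBasis j
  have t2 : (Matrix.pinch Mp Ma * opMatrix e LB).trace =
      ((∑ k, hMb.eigenvalues k * Real.log (hMb.eigenvalues k) : ℝ) : ℂ) := by
    refine trace_mul_eq_sum_of_mulVec hMb fun j => ?_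
    refine h.opMatrix_log_mulVec hp hε hB (pB.eigenvalues_pos j) ?_
    rw [hb]
    exact hMb.mulVec_eigenvectorBasis j
  -- the logarithm of the pinching is block diagonal
  have t3 : (Ma * opMatrix e LB).trace = (Matrix.pinch Mp Ma * opMatrix e LB).trace := by
    have hPB : Commute P B := by
      have z1 : P * (1 - P) = 0 := by rw [mul_sub, hP.isIdempotentElem.eq, mul_one, sub_self]
      have z2 : (1 - P) * P = 0 := by rw [sub_mul, hP.isIdempotentElem.eq, one_mul, sub_self]
      rw [Commute, SemiconjBy, hBA, mul_add, add_mul]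
      simp only [mul_assoc, z2, hP.isIdempotentElem.eq]
      simp only [← mul_assoc, z1, hP.isIdempotentElem.eq]
      simp
    have hPc : Commute (compr p B) P := (hpP.mul_left hPB.symm).mul_left hpP
    have hPL : Commute LB P := hPc.cfc_real _
    have hc : Commute Mp (opMatrix e LB) := by
      rw [Commute, SemiconjBy, ← hMp, ← h.opMatrix_mul hp hpP.symm, ← h.opMatrix_mul hp cLB,
        hPL.eq]
    rw [Matrix.trace_mul_comm Ma, Matrix.trace_mul_comm (Matrix.pinch Mp Ma),
      Matrix.trace_mul_pinch hMpp hc]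
  rw [t1, t3, t2]
  push_cast
  ring

theorem exists_isFrame (hp : IsStarProjection p) [FiniteDimensional ℂ p.range] :
    ∃ (n : ℕ) (e : Fin n → H), IsFrame e p := by
  set v := stdOrthonormalBasis ℂ p.range
  refine ⟨_, fun i => (v i : H), ?_, fun x => ?_⟩
  · exact v.orthonormal.comp_linearIsometry p.range.subtypeₗᵢ
  · have h := congrArg (Subtype.val) (v.sum_repr' ⟨p x, x, rfl⟩)
    refine h.symm.trans ?_
    rw [Submodule.coe_sum]
    refine Finset.sum_congr rfl fun i _ => ?_
    obtain ⟨y, hy⟩ := (v i).2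
    have hpv : p (v i : H) = v i := by
      rw [← hy]
      exact congrArg (fun X : H →L[ℂ] H => X y) hp.isIdempotentElem.eq
    have e1 : ⟪(v i : H), p x⟫_ℂ = ⟪(v i : H), x⟫_ℂ := by
      conv_rhs => rw [← hpv, ← ContinuousLinearMap.adjoint_inner_right,
        ← ContinuousLinearMap.star_eq_adjoint, hp.isSelfAdjoint.star_eq]
    rw [Submodule.coe_smul, ← e1]
    rfl

/-- For finite-rank projections `p ≤ q` commuting with `P`, both traces are real and the one for `p`
is at most the one for `q`. -/
theorem tsum_inner_entropyOp_mono {q : H →L[ℂ] H} (hp : IsStarProjection p)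
    (hq : IsStarProjection q) [FiniteDimensional ℂ p.range] [FiniteDimensional ℂ q.range]
    (hpq : p * q = p)
    {A B P : H →L[ℂ] H} {ε : ℝ} (hε : 0 < ε) (hA : ε • (1 : H →L[ℂ] H) ≤ A)
    (hB : ε • (1 : H →L[ℂ] H) ≤ B) (hP : IsStarProjection P) (hpP : Commute p P)
    (hqP : Commute q P)
    (hBA : B = P * A * P + (1 - P) * A * (1 - P)) {κ : Type*} (b : HilbertBasis κ ℂ H) :
    ∃ s t : ℝ, s ≤ t ∧
      ∑' j, ⟪b j, entropyOp (compr p A) (compr p B) (b j)⟫_ℂ = s ∧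
      ∑' j, ⟪b j, entropyOp (compr q A) (compr q B) (b j)⟫_ℂ = t := by
  have hqp : q * p = p := by
    have := congrArg star hpq
    rwa [star_mul, hp.isSelfAdjoint.star_eq, hq.isSelfAdjoint.star_eq] at this
  have hd : IsStarProjection (q - p) := by
    refine ⟨?_, hq.isSelfAdjoint.sub hp.isSelfAdjoint⟩
    rw [IsIdempotentElem, mul_sub, sub_mul, sub_mul, hpq, hqp, hp.isIdempotentElem.eq,
      hq.isIdempotentElem.eq, sub_self, sub_zero]
  have : FiniteDimensional ℂ (q - p).range := by
    refine Submodule.finiteDimensional_of_le (S₂ := q.range) ?_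
    rintro _ ⟨x, rfl⟩
    refine ⟨(q - p) x, ?_⟩
    have : q * (q - p) = q - p := by rw [mul_sub, hq.isIdempotentElem.eq, hqp]
    exact congrArg (fun X : H →L[ℂ] H => X x) this
  obtain ⟨m, e₁, h₁⟩ := exists_isFrame hp
  obtain ⟨n, e₂, h₂⟩ := exists_isFrame hd
  have hpd : p * (q - p) = 0 := by rw [mul_sub, hpq, hp.isIdempotentElem.eq, sub_self]
  have cross : ∀ (X : H →L[ℂ] H), Commute p X → ∀ i j, ⟪e₁ i, X (e₂ j)⟫_ℂ = 0 := by
    intro X hX i j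
    rw [← h₁.inner_left hp, ← mul_apply_eq_comp p X, hX.eq, mul_apply_eq_comp, ← h₂.apply_self j,
      ← mul_apply_eq_comp p, hpd]
    simp
  have h : IsFrame (Sum.elim e₁ e₂) q := by
    refine ⟨?_, fun x => ?_⟩
    · rw [orthonormal_iff_ite]
      have c1 := fun i j => cross 1 (Commute.one_right p) i j
      simp only [one_apply_eq_self] at c1
      rintro (i | i) (j | j)
      · simpa using orthonormal_iff_ite.1 h₁.orthonormal i j
      · simpa using c1 i j
      · simpa using inner_eq_zero_symm.1 (c1 j i)
      · simpa using orthonormal_iff_ite.1 h₂.orthonormal i j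
    · rw [Fintype.sum_sum_type]
      simp only [Sum.elim_inl, Sum.elim_inr]
      rw [← h₁.apply_eq, ← h₂.apply_eq, sub_apply, add_sub_cancel]
  have hAs := (isSelfAdjoint_of_smul_one_le hε hA).1
  set C : Matrix (Fin m) (Fin n) ℂ := Matrix.of fun i j => ⟪e₁ i, A (e₂ j)⟫_ℂ with hC
  have bA : opMatrix (Sum.elim e₁ e₂) A =
      Matrix.fromBlocks (opMatrix e₁ A) C Cᴴ (opMatrix e₂ A) := by
    ext (i | i) (j | j)
    · rfl
    · rfl
    · have h3 := ContinuousLinearMap.adjoint_inner_right A (e₂ i) (e₁ j)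
      rw [← ContinuousLinearMap.star_eq_adjoint, hAs.star_eq] at h3
      simp only [opMatrix, Matrix.of_apply, Sum.elim_inl, Sum.elim_inr, Matrix.fromBlocks_apply₂₁,
        Matrix.conjTranspose_apply, hC]
      rw [h3]
      exact (inner_conj_symm _ _).symm
    · rfl
  have bP : opMatrix (Sum.elim e₁ e₂) P =
      Matrix.fromBlocks (opMatrix e₁ P) 0 0 (opMatrix e₂ P) := by
    ext (i | i) (j | j)
    · rfl
    · exact cross P hpP i j
    · have h3 := ContinuousLinearMap.adjoint_inner_right P (e₂ i) (e₁ j)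
      rw [← ContinuousLinearMap.star_eq_adjoint, hP.isSelfAdjoint.star_eq] at h3
      simp only [opMatrix, Matrix.of_apply, Sum.elim_inl, Sum.elim_inr, Matrix.fromBlocks_apply₂₁]
      rw [h3, ← inner_conj_symm, cross P hpP j i]
      simp
    · rfl
  have pM : (Matrix.fromBlocks (opMatrix e₁ A) C Cᴴ (opMatrix e₂ A)).PosDef :=
    bA ▸ posDef_opMatrix h.orthonormal hε hA
  have pA := posDef_opMatrix h₁.orthonormal hε hA
  have s1 : (opMatrix e₁ P)ᴴ = opMatrix e₁ P := by
    rw [opMatrix_conjTranspose, hP.isSelfAdjoint.star_eq]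
  have s2 : (opMatrix e₂ P)ᴴ = opMatrix e₂ P := by
    rw [opMatrix_conjTranspose, hP.isSelfAdjoint.star_eq]
  have i1 : opMatrix e₁ P * opMatrix e₁ P = opMatrix e₁ P := by
    rw [← h₁.opMatrix_mul hp hpP.symm, hP.isIdempotentElem.eq]
  have i2 : opMatrix e₂ P * opMatrix e₂ P = opMatrix e₂ P := by
    rw [← h₂.opMatrix_mul hd (hqP.sub_left hpP).symm, hP.isIdempotentElem.eq]
  have s3 : (Matrix.fromBlocks (opMatrix e₁ P) 0 0 (opMatrix e₂ P))ᴴ =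
      Matrix.fromBlocks (opMatrix e₁ P) 0 0 (opMatrix e₂ P) := by
    rw [Matrix.fromBlocks_conjTranspose, s1, s2, Matrix.conjTranspose_zero,
      Matrix.conjTranspose_zero]
  exact ⟨_, _, Matrix.entropy_block_le pM s1 i1 s2 i2 (pM.pinch s3).isHermitian pA.isHermitian
      (pA.pinch s1).isHermitian,
    h₁.tsum_inner_entropyOp hp hε hA hB hP hpP hBA b rfl rfl _ _,
    h.tsum_inner_entropyOp hq hε hA hB hP hqP hBA b bA bP _ _⟩

end TraceIneq

/-! ### Approximation by finite rank -/

namespace TraceIneq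

variable {H : Type*} [NormedAddCommGroup H] [InnerProductSpace ℂ H] [CompleteSpace H]

/-- There is a net of finite-rank projections above `p`, commuting with `P`, that converges pointwise
to `1`: project onto the span of `F`, `P F` and the range of `p`, for finite sets `F` of vectors. -/
theorem exists_finite_projections {P p : H →L[ℂ] H} (hP : IsStarProjection P)
    (hp : IsStarProjection p) [FiniteDimensional ℂ p.range] (hpP : Commute p P) :
    ∃ q : Finset H → H →L[ℂ] H, (∀ F, IsStarProjection (q F)) ∧
      (∀ F, FiniteDimensional ℂ (q F).range) ∧ (∀ F, Commute (q F) P) ∧ (∀ F, p * q F = p) ∧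
      ∀ x, ∀ᶠ F in Filter.atTop, q F x = x := by
  classical
  let U : Finset H → Submodule ℂ H := fun F =>
    Submodule.span ℂ (F : Set H) ⊔ (Submodule.span ℂ (F : Set H)).map P.toLinearMap ⊔ p.range
  have hU : ∀ F, FiniteDimensional ℂ (U F) := fun F => by
    have : FiniteDimensional ℂ (Submodule.span ℂ (F : Set H)) :=
      FiniteDimensional.span_of_finite ℂ F.finite_toSet
    infer_instance
  have hPU : ∀ F, ∀ x ∈ U F, P x ∈ U F := by
    intro F x hx
    obtain ⟨y, hy, z, hz, rfl⟩ := Submodule.mem_sup.1 hx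
    obtain ⟨u, hu, w, hw, rfl⟩ := Submodule.mem_sup.1 hy
    obtain ⟨w', hw', rfl⟩ := hw
    obtain ⟨z', rfl⟩ := hz
    rw [map_add, map_add]
    refine add_mem (add_mem ?_ ?_) ?_
    · exact Submodule.mem_sup_left (Submodule.mem_sup_right ⟨u, hu, rfl⟩)
    · refine Submodule.mem_sup_left (Submodule.mem_sup_right ⟨w', hw', ?_⟩)
      exact (congrArg (fun X : H →L[ℂ] H => X w') hP.isIdempotentElem.eq).symm
    · refine Submodule.mem_sup_right ⟨P z', ?_⟩
      exact congrArg (fun X : H →L[ℂ] H => X z') hpP.eq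
  have hproj : ∀ F, IsStarProjection ((U F).starProjection) := fun F => isStarProjection_starProjection
  refine ⟨fun F => (U F).starProjection, hproj, fun F => ?_, fun F => ?_, fun F => ?_, fun x => ?_⟩
  · rw [Submodule.range_starProjection]
    exact hU F
  · have h1 : (U F).starProjection * (P * (U F).starProjection) = P * (U F).starProjection := by
      ext x
      exact Submodule.starProjection_eq_self_iff.2 (hPU F _ (Submodule.starProjection_apply_mem _ x))
    have h2 := congrArg star h1
    simp only [star_mul, hP.isSelfAdjoint.star_eq, (hproj F).isSelfAdjoint.star_eq] at h2
    rw [Commute, SemiconjBy, ← h2, mul_assoc, h1]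
  · have h1 : (U F).starProjection * p = p := by
      ext x
      exact Submodule.starProjection_eq_self_iff.2 (Submodule.mem_sup_right ⟨x, rfl⟩)
    have h2 := congrArg star h1
    rwa [star_mul, hp.isSelfAdjoint.star_eq, (hproj F).isSelfAdjoint.star_eq] at h2
  · filter_upwards [Filter.eventually_ge_atTop ({x} : Finset H)] with F hF
    refine Submodule.starProjection_eq_self_iff.2 ?_
    exact Submodule.mem_sup_left (Submodule.mem_sup_left
      (Submodule.subset_span (hF (Finset.mem_singleton_self x))))

theorem isHilbertSchmidt_of_sq_eq_abs {T S : H →L[ℂ] H} (hT : IsTraceClass T)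
    (hS : IsSelfAdjoint S) (h : S * S = CFC.abs T) (w : Set H) (b : HilbertBasis w ℂ H) :
    IsHilbertSchmidt b S := by
  refine (hT w b).congr fun i => ?_
  rw [← h, mul_apply_eq_comp]
  have h1 := ContinuousLinearMap.adjoint_inner_left S (S (b i)) (b i)
  rw [← ContinuousLinearMap.star_eq_adjoint, hS.star_eq] at h1
  rw [← h1, inner_self_eq_norm_sq_to_K]
  norm_cast

end TraceIneq

theorem mainTheorem6 {H : Type*} [NormedAddCommGroup H] [InnerProductSpace ℂ H] [CompleteSpace H]
    (A B P₁ P₂ p : H →L[ℂ] H) (ε : ℝ) (hε : 0 < ε)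
    (hA : ε • (1 : H →L[ℂ] H) ≤ A)
    (hP₁ : IsStarProjection P₁) (hP : P₁ + P₂ = 1)
    (hB : B = P₁ * A * P₁ + P₂ * A * P₂)
    (hAB : TraceIneq.IsTraceClass (A - B))
    (hp : IsStarProjection p) (hfin : FiniteDimensional ℂ p.range) (hcomm : Commute p P₁) :
    TraceIneq.IsTraceClass (TraceIneq.entropyOp A B) ∧
    TraceIneq.IsTraceClass
      (TraceIneq.entropyOp (TraceIneq.compr p A) (TraceIneq.compr p B)) ∧
    (TraceIneq.trace (TraceIneq.entropyOp A B)).im = 0 ∧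
    (TraceIneq.trace
      (TraceIneq.entropyOp (TraceIneq.compr p A) (TraceIneq.compr p B))).im = 0 ∧
    (TraceIneq.trace
      (TraceIneq.entropyOp (TraceIneq.compr p A) (TraceIneq.compr p B))).re ≤
        (TraceIneq.trace (TraceIneq.entropyOp A B)).re := by
  obtain rfl : P₂ = 1 - P₁ := eq_sub_of_add_eq' hP
  have hBε : ε • (1 : H →L[ℂ] H) ≤ B := by
    have h1 := TraceIneq.compr_nonneg hP₁ (sub_nonneg.2 hA)
    have h2 := TraceIneq.compr_nonneg hP₁.one_sub (sub_nonneg.2 hA)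
    have e : TraceIneq.compr P₁ (A - ε • 1) + TraceIneq.compr (1 - P₁) (A - ε • 1) = B - ε • 1 := by
      have e1 : ∀ Q : H →L[ℂ] H, IsStarProjection Q →
          TraceIneq.compr Q (A - ε • 1) = Q * A * Q - ε • Q := fun Q hQ => by
        simp only [TraceIneq.compr, mul_sub, sub_mul, mul_smul_comm, smul_mul_assoc, mul_one,
          hQ.isIdempotentElem.eq]
      rw [e1 _ hP₁, e1 _ hP₁.one_sub, hB, smul_sub]
      abel
    exact sub_nonneg.1 (e ▸ add_nonneg h1 h2)
  -- a common centre for the power series of `ln A` and `ln B` and of all their compressions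
  set M := ‖A‖ + ‖B‖ + ε with hM
  have hMA : ‖A‖ ≤ M := by linarith [norm_nonneg B]
  have hMB : ‖B‖ ≤ M := by linarith [norm_nonneg A]
  have hεM : ε ≤ M := by linarith [norm_nonneg A, norm_nonneg B]
  have hTsa : IsSelfAdjoint (A - B) := (TraceIneq.isSelfAdjoint_of_smul_one_le hε hA).1.sub
    (TraceIneq.isSelfAdjoint_of_smul_one_le hε hBε).1
  obtain ⟨S, Q, hSa, hQa, hT, hSS, hQQ⟩ := TraceIneq.exists_selfAdjoint_factors hTsa
  have hS := TraceIneq.isHilbertSchmidt_of_sq_eq_abs hAB hSa hSS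
  have hQ := TraceIneq.isHilbertSchmidt_of_sq_eq_abs hAB hQa hQQ
  have key : ∀ q : H →L[ℂ] H, IsStarProjection q → ∀ (w : Set H) (b : HilbertBasis w ℂ H),
      _ := fun q hq w b => TraceIneq.entropyOp_traceBound_and_trace hε hA hBε hMA hMB hεM hq hT
        hSa hQa (hS w b) (hQ w b)
  have h1 : ∀ X : H →L[ℂ] H, TraceIneq.compr 1 X = X := fun X => by simp [TraceIneq.compr]
  have hone : IsStarProjection (1 : H →L[ℂ] H) := .one _
  refine ⟨?_, ?_, ?_⟩
  · intro w b
    obtain ⟨C, hC⟩ := (key 1 hone w b).1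
    rw [h1, h1] at hC
    exact hC.summable_abs
  · intro w b
    obtain ⟨C, hC⟩ := (key p hp w b).1
    exact hC.summable_abs
  obtain ⟨q, hq, hqfin, hqP, hpq, hlim⟩ := TraceIneq.exists_finite_projections hP₁ hp hcomm
  have htend := TraceIneq.tendsto_tsum_logTrace hε hA hBε hMA hMB hεM
    (hS _ (TraceIneq.basis H)) (hQ _ (TraceIneq.basis H)) hq hlim
  have e1 := (key 1 hone _ (TraceIneq.basis H)).2
  rw [h1, h1] at e1
  rw [← e1] at htend
  simp only [← fun F => (key (q F) (hq F) _ (TraceIneq.basis H)).2] at htend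
  have hmono := fun F => TraceIneq.tsum_inner_entropyOp_mono hp (hq F) (hpq F) hε hA hBε hP₁ hcomm
    (hqP F) hB (TraceIneq.basis H)
  choose s t hst hs ht using hmono
  simp only [ht] at htend
  have him := (Complex.continuous_im.tendsto _).comp htend
  have hre := (Complex.continuous_re.tendsto _).comp htend
  refine ⟨?_, ?_, ?_⟩
  · exact tendsto_nhds_unique him (by simp [Function.comp_def])
  · rw [TraceIneq.trace, hs ∅, Complex.ofReal_im]
  · refine ge_of_tendsto hre (Filter.Eventually.of_forall fun F => ?_)
    rw [TraceIneq.trace, hs F]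
    simpa using hst F
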